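/- Let $\mathfrak g$ be a real Lie algebra. A left-invariant almost Hermitian structure on $\mathfrak g$ is a pair $(g,J)$ of an inner product $g$ on $\mathfrak g$ and a linear map $J:\mathfrak g\to\mathfrak g$ with $J^2=-\mathrm{Id}$ and $g(JX,JY)=g(X,Y)$ (one says that $J$ is compatible with $g$); put $\omega(X,Y)=g(JX,Y)$. Let $\nabla$ be the Levi-Civita connection of $g$ (given on $\mathfrak g$ by the Koszul formula $2g(\nabla_XY,Z)=g([X,Y],Z)-g([Y,Z],X)+g([Z,X],Y)$) and $R_{XYZW}=g(\nabla_X\nabla_YZ-\nabla_Y\nabla_XZ-\nabla_{[X,Y]}Z,\,W)$ its curvature tensor; $g$ is flat if $R=0$. The structure $(g,J)$ is of class $\mathcal{AH}_1$ if $R_{XYZW}=R_{XY\,JZ\,JW}$ for all $X,Y,Z,W\in\mathfrak g$, and it is Kähler if the Nijenhuis tensor $N(X,Y)=[JX,JY]-[X,Y]-J[JX,Y]-J[X,JY]$ vanishes and $d\omega=0$, where $d\omega(X,Y,Z)=-\omega([X,Y],Z)-\omega([Y,Z],X)-\omega([Z,X],Y)$. Let $\mathcal A_{3,6}\oplus\mathcal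 A_1$ be the 4-dimensional real Lie algebra with basis $e_1,e_2,e_3,e_4$ whose only non-zero brackets, up to antisymmetry, are $[e_1,e_3]=-e_2$ and $[e_2,e_3]=e_1$. **Theorem.** 1. A 4-dimensional real Lie algebra admits a non-Kähler left-invariant $\mathcal{AH}_1$-structure if and only if it is isomorphic to $\mathcal A_{3,6}\oplus\mathcal A_1$. 2. The metric $\sum_{i=1}^4 e^i\otimes e^i$ on $\mathcal A_{3,6}\oplus\mathcal A_1$ is flat. 3. A left-invariant almost Hermitian structure $(g,J)$ on $\mathcal A_{3,6}\oplus\mathcal A_1$ is a non-Kähler $\mathcal{AH}_1$-structure if and only if $g$ is flat and $(g,J)$ is not Kähler. 4. Every flat left-invariant metric on $\mathcal A_{3,6}\oplus\mathcal A_1$ has a compatible almost complex structure $J$ for which $(g,J)$ is not Kähler. -/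

import Mathlib

/-!
Left-invariant almost Hermitian structures on a Lie group are described on its Lie algebra `𝔤`:
a left-invariant Riemannian metric is an inner product on `𝔤`, a left-invariant almost complex
structure is an endomorphism of `𝔤`, and all differential operations below are evaluated on
left-invariant vector fields, whose bracket is the bracket of `𝔤` and on which every
left-invariant function is constant.
-/

noncomputable section

namespace LieAH

/-- An inner product on a real vector space `V`; on a Lie algebra, a left-invariant Riemannian
metric. -/
structure Metric (V : Type*) [AddCommGroup V] [Module ℝ V] where
  form : LinearMap.BilinForm ℝ V
  symm : ∀ x y, form x y = form y x
  pos : ∀ x, x ≠ 0 → 0 < form x x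

theorem Metric.nondegenerate {V : Type*} [AddCommGroup V] [Module ℝ V] (g : Metric V) :
    g.form.Nondegenerate := by
  refine ⟨fun x hx => ?_, fun x hx => ?_⟩
  · by_contra h
    exact (g.pos x h).ne' (hx x)
  · by_contra h
    exact (g.pos x h).ne' (hx x)

/-- `J` is an almost complex structure (`J² = -Id`) orthogonal with respect to `g`. -/
structure IsCompatible {V : Type*} [AddCommGroup V] [Module ℝ V] (g : Metric V)
    (J : V →ₗ[ℝ] V) : Prop where
  sq : ∀ x, J (J x) = -x
  orthogonal : ∀ x y, g.form (J x) (J y) = g.form x y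

section

variable {𝔤 : Type*} [LieRing 𝔤] [LieAlgebra ℝ 𝔤]

/-- The right-hand side of the Koszul formula for left-invariant fields, as a linear form in `z`:
`z ↦ ½ (g([x,y],z) - g([y,z],x) + g([z,x],y))`. -/
def koszul (g : Metric 𝔤) (x y : 𝔤) : Module.Dual ℝ 𝔤 where
  toFun z := (1 / 2 : ℝ) * (g.form ⁅x, y⁆ z - g.form ⁅y, z⁆ x + g.form ⁅z, x⁆ y)
  map_add' z w := by
    simp only [map_add, lie_add, add_lie, LinearMap.add_apply]
    ring
  map_smul' c z := by
    simp only [map_smul, lie_smul, smul_lie, LinearMap.smul_apply, smul_eq_mul, RingHom.id_apply]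
    ring

variable [FiniteDimensional ℝ 𝔤]

/-- The Levi-Civita connection `∇_x y` of the left-invariant metric `g`, for left-invariant
fields `x` and `y`. -/
def nabla (g : Metric 𝔤) (x y : 𝔤) : 𝔤 :=
  (g.form.toDual g.nondegenerate).symm (koszul g x y)

theorem form_nabla (g : Metric 𝔤) (x y z : 𝔤) :
    g.form (nabla g x y) z =
      (1 / 2 : ℝ) * (g.form ⁅x, y⁆ z - g.form ⁅y, z⁆ x + g.form ⁅z, x⁆ y) := by
  rw [nabla, LinearMap.BilinForm.apply_toDual_symm_apply]
  rfl

/-- `∇` is compatible with the metric: `g(∇_x y, z) + g(y, ∇_x z) = 0`. -/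
theorem nabla_metric (g : Metric 𝔤) (x y z : 𝔤) :
    g.form (nabla g x y) z + g.form y (nabla g x z) = 0 := by
  rw [g.symm y, form_nabla, form_nabla, ← lie_skew x y, ← lie_skew x z, ← lie_skew z y]
  simp only [map_neg, LinearMap.neg_apply]
  ring

/-- `∇` is torsion-free: `∇_x y - ∇_y x = [x, y]`. -/
theorem nabla_torsion (g : Metric 𝔤) (x y : 𝔤) : nabla g x y - nabla g y x = ⁅x, y⁆ := by
  rw [← sub_eq_zero]
  refine g.nondegenerate.1 _ fun z => ?_
  simp only [map_sub, LinearMap.sub_apply, form_nabla]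
  rw [← lie_skew y x, ← lie_skew x z, ← lie_skew z y]
  simp only [map_neg, LinearMap.neg_apply]
  ring

/-- The Riemann curvature `R(x,y)z = ∇_x ∇_y z - ∇_y ∇_x z - ∇_{[x,y]} z`. -/
def curvature (g : Metric 𝔤) (x y z : 𝔤) : 𝔤 :=
  nabla g x (nabla g y z) - nabla g y (nabla g x z) - nabla g ⁅x, y⁆ z

/-- The curvature tensor `R_{xyzw} = g(R(x,y)z, w)`. -/
def curvatureTensor (g : Metric 𝔤) (x y z w : 𝔤) : ℝ :=
  g.form (curvature g x y z) w

/-- The metric is flat: its Riemann curvature vanishes identically. -/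
def IsFlat (g : Metric 𝔤) : Prop := ∀ x y z, curvature g x y z = 0

/-- The first Gray condition `R_{xyzw} = R_{xy JzJw}`, defining the class `AH₁`. -/
def IsAH1 (g : Metric 𝔤) (J : 𝔤 →ₗ[ℝ] 𝔤) : Prop :=
  ∀ x y z w, curvatureTensor g x y z w = curvatureTensor g x y (J z) (J w)

end

section

variable {𝔤 : Type*} [LieRing 𝔤] [LieAlgebra ℝ 𝔤]

/-- The Nijenhuis tensor of `J`. -/
def nijenhuis (J : 𝔤 →ₗ[ℝ] 𝔤) (x y : 𝔤) : 𝔤 :=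
  ⁅J x, J y⁆ - ⁅x, y⁆ - J ⁅J x, y⁆ - J ⁅x, J y⁆

/-- The fundamental form `ω(x,y) = g(Jx,y)`. -/
def omega (g : Metric 𝔤) (J : 𝔤 →ₗ[ℝ] 𝔤) (x y : 𝔤) : ℝ := g.form (J x) y

/-- The exterior derivative of the left-invariant 2-form `ω` on left-invariant fields. -/
def dOmega (g : Metric 𝔤) (J : 𝔤 →ₗ[ℝ] 𝔤) (x y z : 𝔤) : ℝ :=
  -omega g J ⁅x, y⁆ z - omega g J ⁅y, z⁆ x - omega g J ⁅z, x⁆ y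

/-- `(g, J)` is Kähler: `J` is integrable and `ω` is closed. -/
def IsKahler (g : Metric 𝔤) (J : 𝔤 →ₗ[ℝ] 𝔤) : Prop :=
  (∀ x y, nijenhuis J x y = 0) ∧ ∀ x y z, dOmega g J x y z = 0

end

/-- The Lie algebra `A_{3,6} ⊕ A_1`: it has a basis `e₁, e₂, e₃, e₄` whose only non-zero brackets
are `[e₁,e₃] = -e₂`, `[e₂,e₃] = e₁` and those that follow by antisymmetry. An element
`c1 e₁ + c2 e₂ + c3 e₃ + c4 e₄` is given by its coordinates. -/
@[ext]
structure A36A1 where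
  c1 : ℝ
  c2 : ℝ
  c3 : ℝ
  c4 : ℝ

namespace A36A1

instance : Zero A36A1 := ⟨⟨0, 0, 0, 0⟩⟩

instance : Add A36A1 := ⟨fun x y => ⟨x.c1 + y.c1, x.c2 + y.c2, x.c3 + y.c3, x.c4 + y.c4⟩⟩

instance : Neg A36A1 := ⟨fun x => ⟨-x.c1, -x.c2, -x.c3, -x.c4⟩⟩

instance : SMul ℝ A36A1 := ⟨fun a x => ⟨a * x.c1, a * x.c2, a * x.c3, a * x.c4⟩⟩

instance : Bracket A36A1 A36A1 :=
  ⟨fun x y => ⟨x.c2 * y.c3 - x.c3 * y.c2, -(x.c1 * y.c3 - x.c3 * y.c1), 0, 0⟩⟩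

theorem zero_def : (0 : A36A1) = ⟨0, 0, 0, 0⟩ := rfl

theorem add_def (x y : A36A1) :
    x + y = ⟨x.c1 + y.c1, x.c2 + y.c2, x.c3 + y.c3, x.c4 + y.c4⟩ := rfl

theorem neg_def (x : A36A1) : -x = ⟨-x.c1, -x.c2, -x.c3, -x.c4⟩ := rfl

theorem smul_def (a : ℝ) (x : A36A1) : a • x = ⟨a * x.c1, a * x.c2, a * x.c3, a * x.c4⟩ := rfl

theorem lie_def (x y : A36A1) :
    ⁅x, y⁆ = ⟨x.c2 * y.c3 - x.c3 * y.c2, -(x.c1 * y.c3 - x.c3 * y.c1), 0, 0⟩ := rfl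

instance : AddCommGroup A36A1 where
  add_assoc x y z := by ext <;> simp only [add_def] <;> ring
  zero_add x := by ext <;> simp only [add_def, zero_def] <;> ring
  add_zero x := by ext <;> simp only [add_def, zero_def] <;> ring
  add_comm x y := by ext <;> simp only [add_def] <;> ring
  neg_add_cancel x := by ext <;> simp only [add_def, neg_def, zero_def] <;> ring
  nsmul := nsmulRec
  zsmul := zsmulRec

instance : Module ℝ A36A1 where
  one_smul x := by ext <;> simp only [smul_def] <;> ring
  mul_smul a b x := by ext <;> simp only [smul_def] <;> ring
  smul_zero a := by ext <;> simp only [smul_def, zero_def] <;> ring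
  smul_add a x y := by ext <;> simp only [smul_def, add_def] <;> ring
  add_smul a b x := by ext <;> simp only [smul_def, add_def] <;> ring
  zero_smul x := by ext <;> simp only [smul_def, zero_def] <;> ring

instance : LieRing A36A1 where
  add_lie x y z := by ext <;> simp only [lie_def, add_def] <;> ring
  lie_add x y z := by ext <;> simp only [lie_def, add_def] <;> ring
  lie_self x := by ext <;> simp only [lie_def, zero_def] <;> ring
  leibniz_lie x y z := by ext <;> simp only [lie_def, add_def] <;> ring

instance : LieAlgebra ℝ A36A1 where
  lie_smul a x y := by ext <;> simp only [lie_def, smul_def] <;> ring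

/-- The coordinates with respect to `e₁, e₂, e₃, e₄`. -/
def coordEquiv : A36A1 ≃ₗ[ℝ] (Fin 4 → ℝ) where
  toFun x := ![x.c1, x.c2, x.c3, x.c4]
  invFun v := ⟨v 0, v 1, v 2, v 3⟩
  map_add' x y := by
    ext i
    fin_cases i <;> rfl
  map_smul' a x := by
    ext i
    fin_cases i <;> rfl
  left_inv x := rfl
  right_inv v := by
    ext i
    fin_cases i <;> rfl

instance : FiniteDimensional ℝ A36A1 := Module.Finite.equiv coordEquiv.symm

theorem finrank_eq : Module.finrank ℝ A36A1 = 4 := by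
  rw [coordEquiv.finrank_eq, Module.finrank_fin_fun]

/-- The metric `∑ eⁱ ⊗ eⁱ` on `A_{3,6} ⊕ A_1`. -/
def stdMetric : Metric A36A1 where
  form := LinearMap.mk₂ ℝ
    (fun x y : A36A1 => x.c1 * y.c1 + x.c2 * y.c2 + x.c3 * y.c3 + x.c4 * y.c4)
    (fun x y z => by simp only [add_def]; ring)
    (fun c x y => by simp only [smul_def, smul_eq_mul]; ring)
    (fun x y z => by simp only [add_def]; ring)
    (fun c x y => by simp only [smul_def, smul_eq_mul]; ring)
  symm x y := by
    simp only [LinearMap.mk₂_apply]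
    ring
  pos x hx := by
    simp only [LinearMap.mk₂_apply]
    have h : x.c1 ≠ 0 ∨ x.c2 ≠ 0 ∨ x.c3 ≠ 0 ∨ x.c4 ≠ 0 := by
      by_contra! h
      exact hx (A36A1.ext h.1 h.2.1 h.2.2.1 h.2.2.2)
    rcases h with h | h | h | h <;> have := mul_self_pos.mpr h <;>
      nlinarith [mul_self_nonneg x.c1, mul_self_nonneg x.c2, mul_self_nonneg x.c3,
        mul_self_nonneg x.c4]

end A36A1

end LieAH

end

open LieAH

/-!
In a unitary frame `b` of a four-dimensional Lie algebra, the self-dual part of the Levi-Civita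
connection consists of three linear forms `σ₀, σ₁, σ₂`, and `(g, J)` is Kähler as soon as
`σ₁ = σ₂ = 0`. The condition `AH₁` and `d² = 0` make the three forms satisfy the Maurer-Cartan
equations of `su(2)`, the first of them up to a constant factor, and the frame can be chosen with
`σ(b₀) = 0`.

If `σ₁ ∧ σ₂ ≠ 0`, the forms have rank three or two. In rank three, the Jacobi identity and
torsion-freeness force the matrix expressing the dual frame through `σ` to be skew-symmetric of
size three, hence singular. In rank two, the common kernel is a `J`-invariant ideal whose
structure constants contradict the Jacobi identity.

So in the non-Kähler case `σ₁` and `σ₂` vanish on the orthogonal complement of a unit vector `u`.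
The dual form `u♭` is then closed and `Ric(u, u) = 0`, so Bochner's formula gives `∇u = 0`, and it
follows that `∇ = u♭ ⊗ ∇ᵤ`. Therefore the metric is flat, and `u` acts on the abelian ideal `u^⊥`
by an infinitesimal rotation, which is the bracket of `A_{3,6} ⊕ A_1`.

Conversely, given any metric on `A_{3,6} ⊕ A_1`, let `J` map a unit central vector to a unit vector
orthogonal to it and not orthogonal to some bracket `[x, y]`; then `dω ≠ 0`.
-/

namespace LieAH

section LinearAlgebra

variable {V : Type*} [AddCommGroup V] [Module ℝ V]

theorem Metric.ext_form (g : Metric V) {x y : V} (h : ∀ z, g.form x z = g.form y z) : x = y := by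
  rw [← sub_eq_zero]
  refine g.nondegenerate.1 _ fun z => ?_
  rw [map_sub, LinearMap.sub_apply, h z, sub_self]

theorem Metric.eq_zero_of_form_self_eq_zero (g : Metric V) {x : V} (h : g.form x x = 0) :
    x = 0 := by
  by_contra hx
  exact (g.pos x hx).ne' h

theorem Metric.form_self_nonneg (g : Metric V) (x : V) : 0 ≤ g.form x x := by
  rcases eq_or_ne x 0 with rfl | hx
  · rw [map_zero]
  · exact (g.pos x hx).le

theorem Metric.exists_smul_unit (g : Metric V) {w : V} (hw : w ≠ 0) :
    ∃ r : ℝ, 0 < r ∧ g.form (r • w) (r • w) = 1 := by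
  have hpos := g.pos w hw
  refine ⟨(√(g.form w w))⁻¹, by positivity, ?_⟩
  simp only [map_smul, LinearMap.smul_apply, smul_eq_mul]
  rw [← mul_assoc, ← mul_inv, Real.mul_self_sqrt hpos.le, inv_mul_cancel₀ hpos.ne']

theorem Metric.exists_unit_forall_eq_zero [FiniteDimensional ℝ V] {ι : Type*} [Fintype ι]
    (g : Metric V) (f : ι → Module.Dual ℝ V) (hι : Fintype.card ι < Module.finrank ℝ V) :
    ∃ w, g.form w w = 1 ∧ ∀ i, f i w = 0 := by
  have hker : LinearMap.ker (LinearMap.pi f) ≠ ⊥ := LinearMap.ker_ne_bot_of_finrank_lt (by simpa)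
  obtain ⟨w, hw, hw0⟩ := Submodule.exists_mem_ne_zero_of_ne_bot hker
  obtain ⟨r, -, hr⟩ := g.exists_smul_unit hw0
  refine ⟨r • w, hr, fun i => ?_⟩
  have hfw : f i w = 0 := congrFun (LinearMap.mem_ker.mp hw) i
  rw [map_smul, hfw, smul_zero]

/-- The exterior product of two linear forms, as a function of two vectors. -/
def wedge (α β : Module.Dual ℝ V) (x y : V) : ℝ := α x * β y - α y * β x

theorem eq_zero_of_forall_wedge_eq_zero {α β : Module.Dual ℝ V} {x p q : V}
    (hpq : wedge α β p q ≠ 0) (hx : ∀ y, wedge α β x y = 0) : α x = 0 ∧ β x = 0 := by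
  have hp := hx p
  have hq := hx q
  unfold wedge at hpq hp hq
  constructor <;> refine (mul_eq_zero.mp ?_).resolve_left hpq
  · linear_combination α p * hq - α q * hp
  · linear_combination β p * hq - β q * hp

theorem eq_zero_of_wedge_eq_zero {α β : Module.Dual ℝ V} (h : ∀ x y, wedge α β x y = 0)
    (hα : α ≠ 0) {x : V} (hx : α x = 0) : β x = 0 := by
  obtain ⟨y, hy⟩ := DFunLike.ne_iff.mp hα
  have hxy := h x y
  rw [wedge, hx, zero_mul, zero_sub, neg_eq_zero] at hxy
  exact (mul_eq_zero.mp hxy).resolve_left hy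

theorem Metric.exists_unit_orthogonal_le_ker [FiniteDimensional ℝ V] (g : Metric V)
    {α : Module.Dual ℝ V} (hα : α ≠ 0) :
    ∃ u, g.form u u = 1 ∧ ∀ x, g.form u x = 0 → α x = 0 := by
  obtain ⟨n, rfl⟩ := (g.form.toDual g.nondegenerate).surjective α
  have hn : n ≠ 0 := fun h => hα (by rw [h, map_zero])
  obtain ⟨r, hr, hu⟩ := g.exists_smul_unit hn
  refine ⟨r • n, hu, fun x hx => ?_⟩
  rw [map_smul, LinearMap.smul_apply, smul_eq_mul] at hx
  exact (mul_eq_zero.mp hx).resolve_left hr.ne'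

theorem Metric.exists_unit_orthogonal_le_ker_of_wedge [FiniteDimensional ℝ V] (g : Metric V)
    {α β : Module.Dual ℝ V} (h : ∀ x y, wedge α β x y = 0) (hne : α ≠ 0 ∨ β ≠ 0) :
    ∃ u, g.form u u = 1 ∧ ∀ x, g.form u x = 0 → α x = 0 ∧ β x = 0 := by
  rcases hne with hα | hβ
  · obtain ⟨u, hu, hker⟩ := g.exists_unit_orthogonal_le_ker hα
    exact ⟨u, hu, fun x hx => ⟨hker x hx, eq_zero_of_wedge_eq_zero h hα (hker x hx)⟩⟩
  · have h' : ∀ x y, wedge β α x y = 0 := fun x y => by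
      have := h y x
      unfold wedge at this ⊢
      linarith
    obtain ⟨u, hu, hker⟩ := g.exists_unit_orthogonal_le_ker hβ
    exact ⟨u, hu, fun x hx => ⟨eq_zero_of_wedge_eq_zero h' hβ (hker x hx), hker x hx⟩⟩

end LinearAlgebra

section Orthonormal

variable {V : Type*} [AddCommGroup V] [Module ℝ V] {ι : Type*} [DecidableEq ι]

/-- `b` is an orthonormal basis for the inner product `g`. -/
def IsOrthonormal (g : Metric V) (b : Module.Basis ι ℝ V) : Prop :=
  ∀ i j, g.form (b i) (b j) = if i = j then 1 else 0

theorem exists_isOrthonormal [Fintype ι] (hV : Fintype.card ι = Module.finrank ℝ V) [Nonempty ι]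
    (g : Metric V) (v : ι → V) (hv : ∀ i j, g.form (v i) (v j) = if i = j then 1 else 0) :
    ∃ b : Module.Basis ι ℝ V, IsOrthonormal g b ∧ ∀ i, b i = v i := by
  have hli : LinearIndependent ℝ v := by
    rw [Fintype.linearIndependent_iff]
    intro c hc i
    have := congrArg (fun x => g.form x (v i)) hc
    simpa [hv] using this
  have hcoe : ∀ i, basisOfLinearIndependentOfCardEqFinrank hli hV i = v i := fun i => by simp
  exact ⟨_, fun i j => by rw [hcoe, hcoe, hv], hcoe⟩

theorem exists_isOrthonormal_apply_eq [FiniteDimensional ℝ V] (hV : Module.finrank ℝ V = 4)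
    (g : Metric V) {u v : V} (hu : g.form u u = 1) (hv : g.form v v = 1) (huv : g.form u v = 0) :
    ∃ b : Module.Basis (Fin 4) ℝ V, IsOrthonormal g b ∧ b 0 = u ∧ b 1 = v := by
  obtain ⟨s, hs, hfs⟩ := g.exists_unit_forall_eq_zero ![g.form u, g.form v] (by simp [hV])
  obtain ⟨t, ht, hft⟩ :=
    g.exists_unit_forall_eq_zero ![g.form u, g.form v, g.form s] (by simp [hV])
  have hus : g.form u s = 0 := hfs 0
  have hvs : g.form v s = 0 := hfs 1
  have hut : g.form u t = 0 := hft 0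
  have hvt : g.form v t = 0 := hft 1
  have hst : g.form s t = 0 := hft 2
  obtain ⟨b, hb, hbv⟩ := exists_isOrthonormal (by simp [hV]) g ![u, v, s, t] (by
    intro i j
    fin_cases i <;> fin_cases j <;>
      simp [hu, hv, hs, ht, huv, hus, hvs, hut, hvt, hst, g.symm v u, g.symm s u, g.symm s v,
        g.symm t u, g.symm t v, g.symm t s])
  exact ⟨b, hb, hbv 0, hbv 1⟩

namespace IsOrthonormal

variable {g : Metric V} {b : Module.Basis ι ℝ V}

theorem repr_eq (hb : IsOrthonormal g b) (x : V) (i : ι) : b.repr x i = g.form x (b i) := by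
  have h : b.coord i = g.form.flip (b i) := b.ext fun j => by
    rw [Module.Basis.coord_apply, b.repr_self, Finsupp.single_apply]
    exact (hb j i).symm
  exact LinearMap.congr_fun h x

theorem ext_form (hb : IsOrthonormal g b) {x y : V} (h : ∀ i, g.form x (b i) = g.form y (b i)) :
    x = y :=
  b.repr.injective <| Finsupp.ext fun i => by rw [hb.repr_eq, hb.repr_eq, h]

variable [Fintype ι]

theorem sum_form_smul (hb : IsOrthonormal g b) (x : V) : ∑ i, g.form x (b i) • b i = x := by
  simp only [← hb.repr_eq, b.sum_repr]

theorem form_eq_sum (hb : IsOrthonormal g b) (x y : V) :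
    g.form x y = ∑ i, g.form x (b i) * g.form y (b i) := by
  conv_lhs => rw [← hb.sum_form_smul y]
  simp only [map_sum, map_smul, smul_eq_mul, mul_comm]

theorem dual_apply_eq_sum (hb : IsOrthonormal g b) (α : Module.Dual ℝ V) (x : V) :
    α x = ∑ i, g.form x (b i) * α (b i) := by
  conv_lhs => rw [← hb.sum_form_smul x]
  simp only [map_sum, map_smul, smul_eq_mul]

theorem trace_eq_sum (hb : IsOrthonormal g b) (f : V →ₗ[ℝ] V) :
    LinearMap.trace ℝ V f = ∑ i, g.form (f (b i)) (b i) := by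
  rw [LinearMap.trace_eq_matrix_trace ℝ b f, Matrix.trace]
  simp only [Matrix.diag_apply, LinearMap.toMatrix_apply, hb.repr_eq]

end IsOrthonormal

end Orthonormal

section UnitaryFrames

variable {V : Type*} [AddCommGroup V] [Module ℝ V] {g : Metric V} {J : V →ₗ[ℝ] V}

theorem IsCompatible.form_left (hJ : IsCompatible g J) (x y : V) :
    g.form (J x) y = -g.form x (J y) := by
  rw [← hJ.orthogonal (J x) y, hJ.sq, map_neg, LinearMap.neg_apply]

theorem IsCompatible.form_self (hJ : IsCompatible g J) (x : V) : g.form (J x) x = 0 := by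
  have h := hJ.form_left x x
  rw [g.symm x] at h
  linarith

/-- An orthonormal basis of a four-dimensional space of the form `b₀, b₁ = J b₀, b₂, b₃ = J b₂`,
where `J² = -1`. -/
structure IsUnitary (g : Metric V) (J : V →ₗ[ℝ] V) (b : Module.Basis (Fin 4) ℝ V) : Prop where
  ortho : IsOrthonormal g b
  map0 : J (b 0) = b 1
  map1 : J (b 1) = -b 0
  map2 : J (b 2) = b 3
  map3 : J (b 3) = -b 2

theorem IsUnitary.isCompatible {b : Module.Basis (Fin 4) ℝ V} (hb : IsUnitary g J b) :
    IsCompatible g J where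
  sq := by
    have h : J.comp J = -LinearMap.id := b.ext fun i => by
      fin_cases i <;> simp [hb.map0, hb.map1, hb.map2, hb.map3]
    exact fun x => LinearMap.congr_fun h x
  orthogonal := by
    have h : g.form.compl₁₂ J J = g.form := LinearMap.BilinForm.ext_basis b fun i j => by
      fin_cases i <;> fin_cases j <;>
        simp [hb.map0, hb.map1, hb.map2, hb.map3, hb.ortho _ _]
    exact fun x y => LinearMap.congr_fun₂ h x y

theorem exists_isUnitary [FiniteDimensional ℝ V] (hV : Module.finrank ℝ V = 4)
    (hJ : IsCompatible g J) {u : V} (hu : g.form u u = 1) :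
    ∃ b, IsUnitary g J b ∧ b 0 = u := by
  obtain ⟨w, hw, hf⟩ := g.exists_unit_forall_eq_zero ![g.form u, g.form (J u)] (by simp [hV])
  have huw : g.form u w = 0 := hf 0
  have hJuw : g.form (J u) w = 0 := hf 1
  have huJw : g.form u (J w) = 0 := by rw [← neg_eq_zero, ← hJ.form_left, hJuw]
  have hself' : ∀ x, g.form x (J x) = 0 := fun x => by rw [g.symm, hJ.form_self]
  obtain ⟨b, hb, hv⟩ := exists_isOrthonormal (by simp [hV]) g ![u, J u, w, J w] (by
    intro i j
    fin_cases i <;> fin_cases j <;>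
      simp [hJ.orthogonal, hJ.form_self, hself', hu, hw, huw, hJuw, huJw, g.symm w, g.symm (J w) u])
  exact ⟨b, ⟨hb, by simp [hv], by simp [hv, hJ.sq], by simp [hv], by simp [hv, hJ.sq]⟩,
    by simp [hv]⟩

theorem exists_isCompatible_apply_eq [FiniteDimensional ℝ V] (hV : Module.finrank ℝ V = 4)
    (g : Metric V) {u v : V} (hu : g.form u u = 1) (hv : g.form v v = 1) (huv : g.form u v = 0) :
    ∃ J : V →ₗ[ℝ] V, IsCompatible g J ∧ J u = v := by
  obtain ⟨b, hb, rfl, rfl⟩ := exists_isOrthonormal_apply_eq hV g hu hv huv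
  let J : V →ₗ[ℝ] V := b.constr ℝ ![b 1, -b 0, b 3, -b 2]
  have hJ : IsUnitary g J b := ⟨hb, by simp [J], by simp [J], by simp [J], by simp [J]⟩
  exact ⟨J, hJ.isCompatible, hJ.map0⟩

end UnitaryFrames

section Connection

variable {𝔤 : Type*} [LieRing 𝔤] [LieAlgebra ℝ 𝔤] [FiniteDimensional ℝ 𝔤]

/-- The Levi-Civita connection `nabla` as a bilinear map. -/
noncomputable def conn (g : Metric 𝔤) : 𝔤 →ₗ[ℝ] 𝔤 →ₗ[ℝ] 𝔤 :=
  LinearMap.mk₂ ℝ (nabla g)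
    (fun x y z => g.ext_form fun w => by
      simp only [map_add, LinearMap.add_apply, form_nabla, add_lie, lie_add]; ring)
    (fun c x y => g.ext_form fun w => by
      simp only [map_smul, LinearMap.smul_apply, form_nabla, smul_lie, lie_smul, smul_eq_mul]; ring)
    (fun x y z => g.ext_form fun w => by
      simp only [map_add, LinearMap.add_apply, form_nabla, add_lie, lie_add]; ring)
    (fun c x y => g.ext_form fun w => by
      simp only [map_smul, LinearMap.smul_apply, form_nabla, smul_lie, lie_smul, smul_eq_mul]; ring)

theorem conn_apply (g : Metric 𝔤) (x y : 𝔤) : conn g x y = nabla g x y := rfl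

theorem lie_eq_conn (g : Metric 𝔤) (x y : 𝔤) : ⁅x, y⁆ = conn g x y - conn g y x :=
  (nabla_torsion g x y).symm

theorem form_conn_left (g : Metric 𝔤) (x y z : 𝔤) :
    g.form (conn g x y) z = -g.form (conn g x z) y := by
  have := nabla_metric g x y z
  rw [g.symm y] at this
  simp only [conn_apply]
  linarith

theorem form_conn_self (g : Metric 𝔤) (x y : 𝔤) : g.form (conn g x y) y = 0 := by
  linarith [form_conn_left g x y y]

theorem curvature_eq_conn (g : Metric 𝔤) (x y z : 𝔤) :
    curvature g x y z = conn g x (conn g y z) - conn g y (conn g x z) - conn g ⁅x, y⁆ z := rfl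

theorem curvature_cyclic (g : Metric 𝔤) (x y z : 𝔤) :
    curvature g x y z + curvature g y z x + curvature g z x y = 0 := by
  have key : ∀ a b c : 𝔤, conn g a (conn g b c) - conn g a (conn g c b) - conn g ⁅b, c⁆ a
      = ⁅a, ⁅b, c⁆⁆ := fun a b c => by
    rw [lie_eq_conn g a, ← map_sub, ← lie_eq_conn g b c]
  have h := lie_jacobi x y z
  rw [← key x y z, ← key y z x, ← key z x y] at h
  rw [← h]
  simp only [curvature_eq_conn]
  abel

theorem curvatureTensor_eq (g : Metric 𝔤) (x y z w : 𝔤) :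
    curvatureTensor g x y z w = g.form (conn g x z) (conn g y w)
      - g.form (conn g y z) (conn g x w) - g.form (conn g ⁅x, y⁆ z) w := by
  simp only [curvatureTensor, curvature_eq_conn, map_sub, LinearMap.sub_apply]
  rw [form_conn_left g x, form_conn_left g y, g.symm (conn g x w), g.symm (conn g y w)]
  ring

theorem curvatureTensor_swap_left (g : Metric 𝔤) (x y z w : 𝔤) :
    curvatureTensor g x y z w = -curvatureTensor g y x z w := by
  simp only [curvatureTensor, curvature_eq_conn, ← lie_skew y x, map_neg, map_sub,
    LinearMap.neg_apply, LinearMap.sub_apply]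
  ring

theorem curvatureTensor_swap_right (g : Metric 𝔤) (x y z w : 𝔤) :
    curvatureTensor g x y z w = -curvatureTensor g x y w z := by
  simp only [curvatureTensor_eq]
  rw [form_conn_left g ⁅x, y⁆, g.symm (conn g x z), g.symm (conn g y z)]
  ring

theorem curvatureTensor_cyclic (g : Metric 𝔤) (x y z w : 𝔤) :
    curvatureTensor g x y z w + curvatureTensor g y z x w + curvatureTensor g z x y w = 0 := by
  simp only [curvatureTensor, ← LinearMap.add_apply, ← map_add, curvature_cyclic, map_zero,
    LinearMap.zero_apply]

theorem curvatureTensor_pair (g : Metric 𝔤) (x y z w : 𝔤) :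
    curvatureTensor g x y z w = curvatureTensor g z w x y := by
  have h1 := curvatureTensor_cyclic g x y z w
  have h2 := curvatureTensor_cyclic g y z w x
  have h3 := curvatureTensor_cyclic g z w x y
  have h4 := curvatureTensor_cyclic g w x y z
  rw [curvatureTensor_swap_right g y z w x, curvatureTensor_swap_right g z w y x,
    curvatureTensor_swap_left g w y z x, curvatureTensor_swap_right g y w z x] at h2
  rw [curvatureTensor_swap_right g w x z y, curvatureTensor_swap_left g x z w y,
    curvatureTensor_swap_right g z x w y] at h3
  rw [curvatureTensor_swap_left g w x y z, curvatureTensor_swap_right g x y w z] at h4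
  linarith [curvatureTensor_swap_left g w x y z, curvatureTensor_swap_right g y w x z]

/-- The almost complex structure `J` is parallel in the direction `x`: `∇_x J = 0`. -/
def IsParallelAlong (g : Metric 𝔤) (J : 𝔤 →ₗ[ℝ] 𝔤) (x : 𝔤) : Prop :=
  ∀ y, conn g x (J y) = J (conn g x y)

theorem isKahler_of_parallel {g : Metric 𝔤} {J : 𝔤 →ₗ[ℝ] 𝔤} (hJ : IsCompatible g J)
    (h : ∀ x, IsParallelAlong g J x) : IsKahler g J := by
  constructor
  · intro x y
    simp only [nijenhuis, lie_eq_conn g, h _ _, map_sub, hJ.sq]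
    abel
  · intro x y z
    have key : ∀ a b c, g.form (J (conn g a b)) c = g.form (J (conn g a c)) b := fun a b c => by
      rw [← h a b, form_conn_left, hJ.form_left, neg_inj, g.symm]
    simp only [dOmega, omega, lie_eq_conn g, map_sub, LinearMap.sub_apply]
    rw [key x y z, key y z x, key z x y]
    ring

theorem isFlat_of_conn_eq_smul {g : Metric 𝔤} {u : 𝔤} (hu : conn g u u = 0)
    (h : ∀ x y, conn g x y = g.form u x • conn g u y) : IsFlat g := by
  intro x y z
  have horth : ∀ w, g.form u (conn g u w) = 0 := fun w => by
    rw [g.symm, form_conn_left, hu, map_zero, LinearMap.zero_apply, neg_zero]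
  have hlie : conn g ⁅x, y⁆ z = 0 := by
    rw [h, lie_eq_conn g, h x y, h y x, map_sub, map_smul, map_smul, horth, horth, smul_zero,
      smul_zero, sub_self, zero_smul]
  rw [curvature_eq_conn, hlie, h y z, h x z, h x, h y, map_smul, map_smul, smul_comm, sub_self,
    sub_zero]

/-- A Bochner formula: the left-hand side is `-Ric(u, u)`, and the hypothesis says that the 1-form
dual to `u` is closed. -/
theorem sum_curvatureTensor_eq {g : Metric 𝔤} {u : 𝔤} {ι : Type*} [Fintype ι] [DecidableEq ι]
    {b : Module.Basis ι ℝ 𝔤} (hb : IsOrthonormal g b) (h : ∀ x y : 𝔤, g.form ⁅x, y⁆ u = 0) :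
    ∑ i, curvatureTensor g u (b i) u (b i) =
      ∑ i, g.form (conn g (b i) u) (conn g (b i) u) := by
  set A : 𝔤 →ₗ[ℝ] 𝔤 := (conn g).flip u
  have hAx : ∀ x, conn g x u = A x := fun x => rfl
  have hsymm : ∀ x y, g.form (A x) y = g.form (A y) x := fun x y => by
    have := h x y
    rw [lie_eq_conn g, map_sub, LinearMap.sub_apply, form_conn_left, form_conn_left g y x] at this
    simp only [hAx] at this
    linarith
  have hAu : A u = 0 := g.ext_form fun y => by
    rw [hsymm, ← hAx, form_conn_self, map_zero, LinearMap.zero_apply]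
  -- `A` is symmetric and `∇_u` is skew, so `tr (A ∘ ∇_u) = 0`.
  have htrace : ∑ i, g.form (A (b i)) (conn g u (b i)) = 0 := by
    have hcomm := LinearMap.trace_mul_comm ℝ A (conn g u)
    rw [hb.trace_eq_sum, hb.trace_eq_sum] at hcomm
    simp only [Module.End.mul_apply, form_conn_left g u (A _), Finset.sum_neg_distrib] at hcomm
    simp only [hsymm (conn g u _), g.symm (conn g u _)] at hcomm
    linarith
  have hterm : ∀ y, curvatureTensor g u y u y =
      g.form (A y) (A y) - 2 * g.form (A y) (conn g u y) := fun y => by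
    rw [curvatureTensor_eq, hAx, hAx, hAx, hAu, hsymm ⁅u, y⁆, lie_eq_conn g, hAx]
    simp only [map_zero, map_sub, LinearMap.zero_apply]
    ring
  simp only [hterm, Finset.sum_sub_distrib, ← Finset.mul_sum, htrace, hAx]
  ring

theorem conn_eq_zero_of_sum_curvatureTensor_eq_zero {g : Metric 𝔤} {u : 𝔤} {ι : Type*} [Fintype ι]
    [DecidableEq ι] {b : Module.Basis ι ℝ 𝔤} (hb : IsOrthonormal g b)
    (h : ∀ x y : 𝔤, g.form ⁅x, y⁆ u = 0) (hsum : ∑ i, curvatureTensor g u (b i) u (b i) = 0)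
    (x : 𝔤) : conn g x u = 0 := by
  rw [sum_curvatureTensor_eq hb h,
    Finset.sum_eq_zero_iff_of_nonneg fun i _ => g.form_self_nonneg _] at hsum
  have hA : (conn g).flip u = 0 := b.ext fun i =>
    g.eq_zero_of_form_self_eq_zero (hsum i (Finset.mem_univ i))
  exact LinearMap.congr_fun hA x

end Connection

section ConnectionForms

variable {𝔤 : Type*} [LieRing 𝔤] [LieAlgebra ℝ 𝔤] [FiniteDimensional ℝ 𝔤] {ι : Type*}

/-- The connection form `ω_{ij} : x ↦ g(∇_x b_i, b_j)` of a frame `b`. -/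
noncomputable def connForm (g : Metric 𝔤) (b : ι → 𝔤) (i j : ι) : Module.Dual ℝ 𝔤 :=
  g.form.flip (b j) ∘ₗ (conn g).flip (b i)

theorem connForm_apply (g : Metric 𝔤) (b : ι → 𝔤) (i j : ι) (x : 𝔤) :
    connForm g b i j x = g.form (conn g x (b i)) (b j) := rfl

theorem connForm_skew (g : Metric 𝔤) (b : ι → 𝔤) (i j : ι) :
    connForm g b i j = -connForm g b j i := by
  ext x
  exact form_conn_left g x (b i) (b j)

theorem connForm_self (g : Metric 𝔤) (b : ι → 𝔤) (i : ι) : connForm g b i i = 0 := by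
  ext x
  exact form_conn_self g x (b i)

theorem IsOrthonormal.curvatureTensor_eq_connForm [Fintype ι] [DecidableEq ι] {g : Metric 𝔤}
    {b : Module.Basis ι ℝ 𝔤} (hb : IsOrthonormal g b) (x y : 𝔤) (k l : ι) :
    curvatureTensor g x y (b k) (b l) =
      ∑ m, wedge (connForm g b k m) (connForm g b l m) x y - connForm g b k l ⁅x, y⁆ := by
  simp only [curvatureTensor_eq, hb.form_eq_sum (conn g _ _) (conn g _ _), ← connForm_apply, wedge,
    Finset.sum_sub_distrib]

theorem IsOrthonormal.form_lie_eq_connForm [Fintype ι] [DecidableEq ι] {g : Metric 𝔤}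
    {b : Module.Basis ι ℝ 𝔤} (hb : IsOrthonormal g b) (x y : 𝔤) (k : ι) :
    g.form ⁅x, y⁆ (b k) = ∑ m, (g.form y (b m) * connForm g b m k x
      - g.form x (b m) * connForm g b m k y) := by
  have hconn : ∀ x y, g.form (conn g x y) (b k) = ∑ m, g.form y (b m) * connForm g b m k x :=
    fun x y => hb.dual_apply_eq_sum (g.form.flip (b k) ∘ₗ conn g x) y
  rw [lie_eq_conn g, map_sub, LinearMap.sub_apply, hconn, hconn, Finset.sum_sub_distrib]

end ConnectionForms

section SelfDualForms

variable {𝔤 : Type*} [LieRing 𝔤] [LieAlgebra ℝ 𝔤] [FiniteDimensional ℝ 𝔤] {g : Metric 𝔤}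
  {J : 𝔤 →ₗ[ℝ] 𝔤} {b : Module.Basis (Fin 4) ℝ 𝔤}

/-- The self-dual part of the connection in an oriented orthonormal frame, in the basis
`e⁰¹ + e²³`, `e⁰² - e¹³`, `e⁰³ + e¹²` of the self-dual 2-forms. In a unitary frame the first of
these is, up to sign, the fundamental form of `J`. -/
noncomputable def selfDualForm (g : Metric 𝔤) (b : Fin 4 → 𝔤) : Fin 3 → Module.Dual ℝ 𝔤 :=
  ![connForm g b 0 1 + connForm g b 2 3, connForm g b 0 2 - connForm g b 1 3,
    connForm g b 0 3 + connForm g b 1 2]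

/-- The 2-form `(x, y) ↦ R(x, y, b₀, b₁) + R(x, y, b₂, b₃)`; in a unitary frame, up to a factor,
the `*`-Ricci form of `J`. -/
noncomputable def ricciForm (g : Metric 𝔤) (b : Fin 4 → 𝔤) (x y : 𝔤) : ℝ :=
  curvatureTensor g x y (b 0) (b 1) + curvatureTensor g x y (b 2) (b 3)

theorem selfDualForm_zero (b : Fin 4 → 𝔤) (x : 𝔤) :
    selfDualForm g b 0 x = connForm g b 0 1 x + connForm g b 2 3 x := rfl

theorem selfDualForm_one (b : Fin 4 → 𝔤) (x : 𝔤) :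
    selfDualForm g b 1 x = connForm g b 0 2 x - connForm g b 1 3 x := rfl

theorem selfDualForm_two (b : Fin 4 → 𝔤) (x : 𝔤) :
    selfDualForm g b 2 x = connForm g b 0 3 x + connForm g b 1 2 x := rfl

theorem ricciForm_swap (b : Fin 4 → 𝔤) (x y : 𝔤) : ricciForm g b x y = -ricciForm g b y x := by
  rw [ricciForm, ricciForm, curvatureTensor_swap_left, curvatureTensor_swap_left g x y (b 2)]
  ring

theorem IsAH1.ricciForm_map_map (hR : IsAH1 g J) (b : Fin 4 → 𝔤) (x y : 𝔤) :
    ricciForm g b (J x) (J y) = ricciForm g b x y := by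
  simp only [ricciForm, curvatureTensor_pair g _ _ (b _), ← hR _ _ x y]

theorem IsOrthonormal.selfDualForm_zero_lie (hb : IsOrthonormal g b) (x y : 𝔤) :
    selfDualForm g b 0 ⁅x, y⁆ =
      wedge (selfDualForm g b 1) (selfDualForm g b 2) x y - ricciForm g b x y := by
  simp only [ricciForm, hb.curvatureTensor_eq_connForm, Fin.sum_univ_four, selfDualForm_zero,
    selfDualForm_one, selfDualForm_two, wedge, connForm_self, connForm_skew g b 1 0,
    connForm_skew g b 2 0, connForm_skew g b 3 0, connForm_skew g b 2 1, connForm_skew g b 3 1,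
    connForm_skew g b 3 2, LinearMap.neg_apply, LinearMap.zero_apply]
  ring

namespace IsUnitary

theorem trace_comp_conn (hb : IsUnitary g J b) (x : 𝔤) :
    LinearMap.trace ℝ 𝔤 (J ∘ₗ conn g x) = -2 * selfDualForm g b 0 x := by
  simp only [hb.ortho.trace_eq_sum, Fin.sum_univ_four, LinearMap.comp_apply,
    hb.isCompatible.form_left, hb.map0, hb.map1, hb.map2, hb.map3, map_neg, ← connForm_apply,
    selfDualForm_zero, connForm_skew g b 1 0, connForm_skew g b 3 2, LinearMap.neg_apply]
  ring

theorem isParallelAlong_iff (hb : IsUnitary g J b) (x : 𝔤) :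
    IsParallelAlong g J x ↔ selfDualForm g b 1 x = 0 ∧ selfDualForm g b 2 x = 0 := by
  constructor
  · intro h
    have hj : ∀ j, g.form (conn g x (b 1)) (b j) = -g.form (conn g x (b 0)) (J (b j)) := fun j => by
      rw [← hb.map0, h, hb.isCompatible.form_left]
    have h2 := hj 2
    have h3 := hj 3
    rw [hb.map2] at h2
    rw [hb.map3, map_neg] at h3
    simp only [selfDualForm_one, selfDualForm_two, connForm_apply]
    constructor <;> linarith
  · rintro ⟨h1, h2⟩
    rw [selfDualForm_one] at h1
    rw [selfDualForm_two] at h2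
    refine LinearMap.congr_fun (f := conn g x ∘ₗ J) (g := J ∘ₗ conn g x)
      (b.ext fun i => hb.ortho.ext_form fun j => ?_)
    rw [LinearMap.comp_apply, LinearMap.comp_apply, hb.isCompatible.form_left]
    fin_cases i <;> fin_cases j <;>
      simp only [Fin.zero_eta, Fin.mk_one, Fin.reduceFinMk, hb.map0, hb.map1, hb.map2, hb.map3,
        map_neg, LinearMap.neg_apply, ← connForm_apply, connForm_self, connForm_skew g b 1 0,
        connForm_skew g b 2 0, connForm_skew g b 3 0, connForm_skew g b 2 1,
        connForm_skew g b 3 1, connForm_skew g b 3 2, LinearMap.zero_apply] <;>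
      linarith

theorem forall_selfDualForm_eq_zero_iff (hb : IsUnitary g J b) (x : 𝔤) :
    (∀ a, selfDualForm g b a x = 0) ↔
      IsParallelAlong g J x ∧ LinearMap.trace ℝ 𝔤 (J ∘ₗ conn g x) = 0 := by
  rw [hb.isParallelAlong_iff, hb.trace_comp_conn, Fin.forall_fin_succ, Fin.forall_fin_two]
  simp [and_comm]

theorem isKahler (hb : IsUnitary g J b) (h1 : selfDualForm g b 1 = 0)
    (h2 : selfDualForm g b 2 = 0) : IsKahler g J :=
  isKahler_of_parallel hb.isCompatible fun x => (hb.isParallelAlong_iff x).mpr (by simp [h1, h2])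

theorem selfDualForm_one_lie (hb : IsUnitary g J b) (hR : IsAH1 g J) (x y : 𝔤) :
    selfDualForm g b 1 ⁅x, y⁆ = wedge (selfDualForm g b 2) (selfDualForm g b 0) x y := by
  have h := hR x y (b 0) (b 2)
  rw [hb.map0, hb.map2] at h
  simp only [hb.ortho.curvatureTensor_eq_connForm, Fin.sum_univ_four, wedge, connForm_self,
    connForm_skew g b 1 0, connForm_skew g b 2 0, connForm_skew g b 3 0, connForm_skew g b 2 1,
    connForm_skew g b 3 1, connForm_skew g b 3 2, LinearMap.neg_apply, LinearMap.zero_apply] at h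
  simp only [selfDualForm_zero, selfDualForm_one, selfDualForm_two, wedge]
  linear_combination -h

theorem selfDualForm_two_lie (hb : IsUnitary g J b) (hR : IsAH1 g J) (x y : 𝔤) :
    selfDualForm g b 2 ⁅x, y⁆ = wedge (selfDualForm g b 0) (selfDualForm g b 1) x y := by
  have h := hR x y (b 0) (b 3)
  rw [hb.map0, hb.map3, curvatureTensor, curvatureTensor, map_neg, ← curvatureTensor,
    ← curvatureTensor] at h
  simp only [hb.ortho.curvatureTensor_eq_connForm, Fin.sum_univ_four, wedge, connForm_self,
    connForm_skew g b 1 0, connForm_skew g b 2 0, connForm_skew g b 3 0, connForm_skew g b 2 1,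
    connForm_skew g b 3 1, connForm_skew g b 3 2, LinearMap.neg_apply, LinearMap.zero_apply] at h
  simp only [selfDualForm_zero, selfDualForm_one, selfDualForm_two, wedge]
  linear_combination -h

theorem sum_curvatureTensor_eq_ricciForm (hb : IsUnitary g J b) (hR : IsAH1 g J) :
    ∑ i, curvatureTensor g (b 0) (b i) (b 0) (b i) = ricciForm g b (b 0) (b 1) := by
  have hneg : ∀ x y z w : 𝔤, curvatureTensor g x y z (-w) = -curvatureTensor g x y z w :=
    fun x y z w => map_neg _ w
  have h00 := curvatureTensor_swap_left g (b 0) (b 0) (b 0) (b 0)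
  have h02 := hR (b 0) (b 2) (b 0) (b 2)
  have h03 := hR (b 0) (b 3) (b 0) (b 3)
  have hcyc := curvatureTensor_cyclic g (b 0) (b 1) (b 2) (b 3)
  rw [hb.map0, hb.map2] at h02
  rw [hb.map0, hb.map3, hneg] at h03
  rw [curvatureTensor_pair g (b 1) (b 2), curvatureTensor_swap_left g (b 2) (b 0)] at hcyc
  rw [Fin.sum_univ_four, ricciForm]
  linarith

theorem sum_selfDualForm_one_mul_ricciForm (hb : IsUnitary g J b) (hR : IsAH1 g J) (x y z : 𝔤) :
    selfDualForm g b 1 x * ricciForm g b y z + selfDualForm g b 1 y * ricciForm g b z x +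
      selfDualForm g b 1 z * ricciForm g b x y = 0 := by
  have h := congrArg (selfDualForm g b 2) (lie_jacobi x y z)
  simp only [map_add, hb.selfDualForm_two_lie hR, hb.selfDualForm_one_lie hR,
    hb.ortho.selfDualForm_zero_lie, wedge, map_zero] at h
  linear_combination h

theorem sum_selfDualForm_two_mul_ricciForm (hb : IsUnitary g J b) (hR : IsAH1 g J) (x y z : 𝔤) :
    selfDualForm g b 2 x * ricciForm g b y z + selfDualForm g b 2 y * ricciForm g b z x +
      selfDualForm g b 2 z * ricciForm g b x y = 0 := by
  have h := congrArg (selfDualForm g b 1) (lie_jacobi x y z)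
  simp only [map_add, hb.selfDualForm_two_lie hR, hb.selfDualForm_one_lie hR,
    hb.ortho.selfDualForm_zero_lie, wedge, map_zero] at h
  linear_combination -h

theorem wedge_mul_ricciForm (hb : IsUnitary g J b) (hR : IsAH1 g J) (p q x y : 𝔤) :
    wedge (selfDualForm g b 1) (selfDualForm g b 2) p q * ricciForm g b x y =
      ricciForm g b p q * wedge (selfDualForm g b 1) (selfDualForm g b 2) x y := by
  have hpqx := hb.sum_selfDualForm_one_mul_ricciForm hR p q x
  have hpqy := hb.sum_selfDualForm_one_mul_ricciForm hR p q y
  have hpxy := hb.sum_selfDualForm_two_mul_ricciForm hR p x y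
  have hqxy := hb.sum_selfDualForm_two_mul_ricciForm hR q x y
  rw [ricciForm_swap b y] at hpxy hqxy
  rw [ricciForm_swap b y] at hpqy
  rw [ricciForm_swap b x] at hpqx
  unfold wedge
  linear_combination selfDualForm g b 1 p * hqxy - selfDualForm g b 1 q * hpxy
    - selfDualForm g b 2 y * hpqx + selfDualForm g b 2 x * hpqy

end IsUnitary

end SelfDualForms

section LinearForms

variable {V : Type*} [AddCommGroup V] [Module ℝ V]

theorem exists_dual_family {ι : Type*} [Finite ι] [DecidableEq ι] {σ : ι → Module.Dual ℝ V}
    (hσ : LinearIndependent ℝ σ) : ∃ f : ι → V, ∀ a c, σ a (f c) = if a = c then 1 else 0 := by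
  have hpeel : ∀ c, ∃ v, ∀ a, σ a v = if a = c then 1 else 0 := fun c => by
    have hc := linearIndependent_iff_notMem_span.mp hσ c
    rw [Set.image_eq_range] at hc
    have hker := mt mem_span_of_iInf_ker_le_ker hc
    obtain ⟨v, hv, hvc⟩ := SetLike.not_le_iff_exists.mp hker
    rw [LinearMap.mem_ker] at hvc
    refine ⟨(σ c v)⁻¹ • v, fun a => ?_⟩
    rw [map_smul, smul_eq_mul]
    split_ifs with hac
    · rw [hac, inv_mul_cancel₀ hvc]
    · have hav : σ a v = 0 := (Submodule.mem_iInf _).mp hv ⟨a, Set.mem_univ a, hac⟩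
      rw [hav, mul_zero]
  choose f hf using hpeel
  exact ⟨f, fun a c => hf c a⟩

theorem linearIndependent_of_wedge_ne_zero {α β : Module.Dual ℝ V} {p q : V}
    (h : wedge α β p q ≠ 0) : LinearIndependent ℝ ![α, β] := by
  refine LinearIndependent.pair_iff.mpr fun s t hst => ?_
  have hp : s * α p + t * β p = 0 := LinearMap.congr_fun hst p
  have hq : s * α q + t * β q = 0 := LinearMap.congr_fun hst q
  unfold wedge at h
  constructor <;> refine (mul_eq_zero.mp ?_).resolve_right h
  · linear_combination β q * hp - β p * hq
  · linear_combination α p * hq - α q * hp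

theorem linearIndependent_or_eq_combination {σ : Fin 3 → Module.Dual ℝ V} {p q : V}
    (h : wedge (σ 1) (σ 2) p q ≠ 0) :
    LinearIndependent ℝ σ ∨ ∃ s t : ℝ, σ 0 = s • σ 1 + t • σ 2 := by
  have htail : Fin.tail σ = ![σ 1, σ 2] := by
    ext i
    fin_cases i <;> rfl
  rw [linearIndependent_finSucc, htail, Matrix.range_cons_cons_empty, Submodule.mem_span_pair]
  refine or_iff_not_imp_right.mpr fun hσ => ⟨linearIndependent_of_wedge_ne_zero h, ?_⟩
  rintro ⟨s, t, hst⟩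
  exact hσ ⟨s, t, hst.symm⟩

end LinearForms

section MaurerCartan

variable {𝔤 : Type*} [LieRing 𝔤] [LieAlgebra ℝ 𝔤]

/-- The linear forms `σ₀, σ₁, σ₂` satisfy the Maurer-Cartan equations of `su(2)`, with the first
equation rescaled by `μ`. -/
structure IsMaurerCartan (σ : Fin 3 → Module.Dual ℝ 𝔤) (μ : ℝ) : Prop where
  zero_lie : ∀ x y, σ 0 ⁅x, y⁆ = μ * wedge (σ 1) (σ 2) x y
  one_lie : ∀ x y, σ 1 ⁅x, y⁆ = wedge (σ 2) (σ 0) x y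
  two_lie : ∀ x y, σ 2 ⁅x, y⁆ = wedge (σ 0) (σ 1) x y

theorem IsMaurerCartan.apply_lie_eq_zero {σ : Fin 3 → Module.Dual ℝ 𝔤} {μ : ℝ}
    (hσ : IsMaurerCartan σ μ) {y : 𝔤} (hy : ∀ a, σ a y = 0) (x : 𝔤) (a : Fin 3) :
    σ a ⁅x, y⁆ = 0 := by
  fin_cases a <;> simp [hσ.zero_lie, hσ.one_lie, hσ.two_lie, wedge, hy]

theorem IsMaurerCartan.scale_nonpos {σ : Fin 3 → Module.Dual ℝ 𝔤} {μ : ℝ}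
    (hσ : IsMaurerCartan σ μ) {p q : 𝔤} (hpq : wedge (σ 1) (σ 2) p q ≠ 0) {s t : ℝ}
    (hdep : σ 0 = s • σ 1 + t • σ 2) : μ ≤ 0 := by
  have h := LinearMap.congr_fun hdep ⁅p, q⁆
  simp only [LinearMap.add_apply, LinearMap.smul_apply, smul_eq_mul] at h
  rw [hσ.zero_lie, hσ.one_lie, hσ.two_lie] at h
  have hμ : μ = -(s ^ 2 + t ^ 2) := by
    refine mul_right_cancel₀ hpq (h.trans ?_)
    simp only [wedge, hdep, LinearMap.add_apply, LinearMap.smul_apply, smul_eq_mul]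
    ring
  rw [hμ]
  nlinarith [sq_nonneg s, sq_nonneg t]

end MaurerCartan

section UnitaryMaurerCartan

variable {𝔤 : Type*} [LieRing 𝔤] [LieAlgebra ℝ 𝔤] [FiniteDimensional ℝ 𝔤] {g : Metric 𝔤}
  {J : 𝔤 →ₗ[ℝ] 𝔤} {b : Module.Basis (Fin 4) ℝ 𝔤}

theorem IsUnitary.isMaurerCartan (hb : IsUnitary g J b) (hR : IsAH1 g J) {p q : 𝔤}
    (hpq : wedge (selfDualForm g b 1) (selfDualForm g b 2) p q ≠ 0) :
    IsMaurerCartan (selfDualForm g b)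
      (1 - ricciForm g b p q / wedge (selfDualForm g b 1) (selfDualForm g b 2) p q) where
  zero_lie x y := by
    rw [hb.ortho.selfDualForm_zero_lie, sub_mul, one_mul, div_mul_eq_mul_div,
      ← hb.wedge_mul_ricciForm hR, mul_div_cancel_left₀ _ hpq]
  one_lie := hb.selfDualForm_one_lie hR
  two_lie := hb.selfDualForm_two_lie hR

end UnitaryMaurerCartan

section DualFrame

variable {V : Type*} [AddCommGroup V] [Module ℝ V] {g : Metric V}
  {n : ℕ} {b : Module.Basis (Fin (n + 1)) ℝ V} {σ : Fin n → Module.Dual ℝ V} {f : Fin n → V}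

theorem IsOrthonormal.matrix_mul_dual_eq_one (hb : IsOrthonormal g b) (hσ : ∀ a, σ a (b 0) = 0)
    (hf : ∀ a c, σ a (f c) = if a = c then 1 else 0) :
    (Matrix.of fun a i => σ a (b i.succ)) * (Matrix.of fun i c => g.form (f c) (b i.succ)) = 1 := by
  ext a c
  have h := hb.dual_apply_eq_sum (σ a) (f c)
  rw [Fin.sum_univ_succ, hσ, mul_zero, zero_add, hf] at h
  simp only [Matrix.mul_apply, Matrix.of_apply, Matrix.one_apply, h, mul_comm]

theorem IsOrthonormal.det_dual_ne_zero (hb : IsOrthonormal g b) (hσ : ∀ a, σ a (b 0) = 0)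
    (hf : ∀ a c, σ a (f c) = if a = c then 1 else 0) :
    (Matrix.of fun i c => g.form (f c) (b i.succ)).det ≠ 0 := fun h => by
  have hinv := congrArg Matrix.det (hb.matrix_mul_dual_eq_one hσ hf)
  rw [Matrix.det_mul, h, mul_zero, Matrix.det_one] at hinv
  exact zero_ne_one hinv

theorem IsOrthonormal.form_eq_sum_dual (hb : IsOrthonormal g b) (hσ : ∀ a, σ a (b 0) = 0)
    (hf : ∀ a c, σ a (f c) = if a = c then 1 else 0) (v : V) (i : Fin n) :
    g.form v (b i.succ) = ∑ c, σ c v * g.form (f c) (b i.succ) := by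
  set S : Matrix (Fin n) (Fin n) ℝ := Matrix.of fun a i => σ a (b i.succ) with hS
  set D : Matrix (Fin n) (Fin n) ℝ := Matrix.of fun i c => g.form (f c) (b i.succ) with hD
  have hSv : (fun a => σ a v) = S.mulVec fun i => g.form v (b i.succ) := by
    ext a
    have h := hb.dual_apply_eq_sum (σ a) v
    rw [Fin.sum_univ_succ, hσ, mul_zero, zero_add] at h
    simp only [h, Matrix.mulVec, dotProduct, hS, Matrix.of_apply, mul_comm]
  have hDv : D.mulVec (fun a => σ a v) = fun i => g.form v (b i.succ) := by
    rw [hSv, Matrix.mulVec_mulVec, mul_eq_one_comm.mp (hb.matrix_mul_dual_eq_one hσ hf),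
      Matrix.one_mulVec]
  rw [← congrFun hDv i]
  simp only [Matrix.mulVec, dotProduct, hD, Matrix.of_apply, mul_comm]

theorem IsOrthonormal.eq_smul_of_dual (hb : IsOrthonormal g b) (hσ : ∀ a, σ a (b 0) = 0)
    (hf : ∀ a c, σ a (f c) = if a = c then 1 else 0) {v : V} (hv : ∀ a, σ a v = 0) :
    v = g.form v (b 0) • b 0 := by
  have hi : ∀ i : Fin n, g.form v (b i.succ) = 0 := fun i => by
    rw [hb.form_eq_sum_dual hσ hf]
    simp only [hv, zero_mul, Finset.sum_const_zero]
  conv_lhs => rw [← hb.sum_form_smul v]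
  simp only [Fin.sum_univ_succ, hi, zero_smul, Finset.sum_const_zero, add_zero]

end DualFrame

section StructureConstants

variable {𝔤 : Type*} [LieRing 𝔤] [LieAlgebra ℝ 𝔤] {ι : Type*}

/-- The structure constants of `𝔤` in the frame `b`, with the last index lowered by `g`. -/
def structConst (g : Metric 𝔤) (b : ι → 𝔤) (i j k : ι) : ℝ := g.form ⁅b i, b j⁆ (b k)

theorem structConst_self (g : Metric 𝔤) (b : ι → 𝔤) (i k : ι) : structConst g b i i k = 0 := by
  rw [structConst, lie_self, map_zero, LinearMap.zero_apply]

theorem structConst_skew (g : Metric 𝔤) (b : ι → 𝔤) (i j k : ι) :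
    structConst g b i j k = -structConst g b j i k := by
  rw [structConst, structConst, ← lie_skew, map_neg, LinearMap.neg_apply]

theorem IsOrthonormal.lie_eq_sum_structConst [Fintype ι] [DecidableEq ι] {g : Metric 𝔤}
    {b : Module.Basis ι ℝ 𝔤} (hb : IsOrthonormal g b) (i j : ι) :
    ⁅b i, b j⁆ = ∑ k, structConst g b i j k • b k :=
  (hb.sum_form_smul _).symm

theorem two_mul_connForm [FiniteDimensional ℝ 𝔤] (g : Metric 𝔤) (b : ι → 𝔤) (i j k : ι) :
    2 * connForm g b i j (b k) =
      structConst g b k i j - structConst g b i j k + structConst g b j k i := by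
  rw [connForm_apply, conn_apply, form_nabla]
  unfold structConst
  ring

theorem two_mul_selfDualForm_zero [FiniteDimensional ℝ 𝔤] (g : Metric 𝔤) (b : Fin 4 → 𝔤)
    (k : Fin 4) :
    2 * selfDualForm g b 0 (b k) =
      structConst g b k 0 1 - structConst g b 0 1 k + structConst g b 1 k 0 +
        (structConst g b k 2 3 - structConst g b 2 3 k + structConst g b 3 k 2) := by
  rw [selfDualForm_zero, mul_add, two_mul_connForm, two_mul_connForm]

theorem two_mul_selfDualForm_one [FiniteDimensional ℝ 𝔤] (g : Metric 𝔤) (b : Fin 4 → 𝔤)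
    (k : Fin 4) :
    2 * selfDualForm g b 1 (b k) =
      structConst g b k 0 2 - structConst g b 0 2 k + structConst g b 2 k 0 -
        (structConst g b k 1 3 - structConst g b 1 3 k + structConst g b 3 k 1) := by
  rw [selfDualForm_one, mul_sub, two_mul_connForm, two_mul_connForm]

theorem two_mul_selfDualForm_two [FiniteDimensional ℝ 𝔤] (g : Metric 𝔤) (b : Fin 4 → 𝔤)
    (k : Fin 4) :
    2 * selfDualForm g b 2 (b k) =
      structConst g b k 0 3 - structConst g b 0 3 k + structConst g b 3 k 0 +
        (structConst g b k 1 2 - structConst g b 1 2 k + structConst g b 2 k 1) := by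
  rw [selfDualForm_two, mul_add, two_mul_connForm, two_mul_connForm]

end StructureConstants

section RankThree

variable {𝔤 : Type*} [LieRing 𝔤] [LieAlgebra ℝ 𝔤] [FiniteDimensional ℝ 𝔤] {g : Metric 𝔤}
  {b : Module.Basis (Fin 4) ℝ 𝔤} {μ : ℝ}

/-- With `χ(x) = g([x, b₀], b₀)`, the condition `σ(b₀) = 0` says that the 2-form `g([x, y], b₀)` is
`2 ⋆χ + χ ∧ b⁰`, where `⋆` is the Hodge star on the orthogonal complement of `b₀`. -/
theorem IsOrthonormal.form_lie_of_lie_eq_smul (hb : IsOrthonormal g b)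
    (hσ0 : ∀ a, selfDualForm g b a (b 0) = 0)
    (hlie : ∀ x : 𝔤, ⁅x, b 0⁆ = g.form ⁅x, b 0⁆ (b 0) • b 0) (x y : 𝔤) :
    g.form ⁅x, y⁆ (b 0) =
      2 * (g.form ⁅b 1, b 0⁆ (b 0) * wedge (g.form (b 2)) (g.form (b 3)) x y +
        g.form ⁅b 2, b 0⁆ (b 0) * wedge (g.form (b 3)) (g.form (b 1)) x y +
        g.form ⁅b 3, b 0⁆ (b 0) * wedge (g.form (b 1)) (g.form (b 2)) x y) +
      (g.form ⁅x, b 0⁆ (b 0) * g.form y (b 0) - g.form x (b 0) * g.form ⁅y, b 0⁆ (b 0)) := by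
  have hoff : ∀ i j, j ≠ 0 → g.form ⁅b i, b 0⁆ (b j) = 0 := fun i j hj => by
    rw [hlie, map_smul, LinearMap.smul_apply, hb, if_neg hj.symm, smul_zero]
  have h0 := two_mul_selfDualForm_zero g b 0
  have h1 := two_mul_selfDualForm_one g b 0
  have h2 := two_mul_selfDualForm_two g b 0
  simp only [hσ0, structConst_self, structConst_skew g b 0, structConst_skew g b 1 3, mul_zero]
    at h0 h1 h2
  simp only [structConst, hoff _ 1 (by decide), hoff _ 2 (by decide), hoff _ 3 (by decide)]
    at h0 h1 h2
  have h23 : g.form ⁅b 2, b 3⁆ (b 0) = 2 * g.form ⁅b 1, b 0⁆ (b 0) := by linarith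
  have h31 : g.form ⁅b 3, b 1⁆ (b 0) = 2 * g.form ⁅b 2, b 0⁆ (b 0) := by linarith
  have h12 : g.form ⁅b 1, b 2⁆ (b 0) = 2 * g.form ⁅b 3, b 0⁆ (b 0) := by linarith
  have hswap : ∀ i j k, g.form ⁅b i, b j⁆ (b k) = -g.form ⁅b j, b i⁆ (b k) := structConst_skew g b
  rw [← hb.sum_form_smul x, ← hb.sum_form_smul y]
  simp only [Fin.sum_univ_four, map_add, add_lie, lie_add, smul_lie, lie_smul, map_smul,
    LinearMap.add_apply, LinearMap.smul_apply, smul_eq_mul, lie_self, map_zero,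
    LinearMap.zero_apply, hswap 0, hswap 2 1, hswap 1 3, hswap 3 2, h23, h31, h12, wedge, hb _ _,
    Fin.reduceEq, one_ne_zero, ↓reduceIte, mul_one, mul_zero]
  ring

theorem IsMaurerCartan.sum_form_lie_dual_mul (hσ : IsMaurerCartan (selfDualForm g b) μ)
    (hb : IsOrthonormal g b) (hσ0 : ∀ a, selfDualForm g b a (b 0) = 0) {f : Fin 3 → 𝔤}
    (hf : ∀ a c, selfDualForm g b a (f c) = if a = c then 1 else 0)
    (hf0 : ∀ c, g.form (f c) (b 0) = 0) :
    g.form ⁅f 1, f 2⁆ (b 0) * g.form ⁅f 0, b 0⁆ (b 0) +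
      g.form ⁅f 2, f 0⁆ (b 0) * g.form ⁅f 1, b 0⁆ (b 0) +
      g.form ⁅f 0, f 1⁆ (b 0) * g.form ⁅f 2, b 0⁆ (b 0) = 0 := by
  have heq : ∀ v w, (∀ a, selfDualForm g b a v = selfDualForm g b a w) →
      g.form w (b 0) = 0 → v = w + g.form v (b 0) • b 0 := fun v w hvw hw => by
    have h := hb.eq_smul_of_dual hσ0 hf (v := v - w) fun a => by rw [map_sub, hvw, sub_self]
    rw [map_sub, LinearMap.sub_apply, hw, sub_zero] at h
    rw [← h, add_sub_cancel]
  have h01 := heq ⁅f 0, f 1⁆ (f 2)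
    (by simp [Fin.forall_fin_succ, hσ.zero_lie, hσ.one_lie, hσ.two_lie, wedge, hf]) (hf0 2)
  have h20 := heq ⁅f 2, f 0⁆ (f 1)
    (by simp [Fin.forall_fin_succ, hσ.zero_lie, hσ.one_lie, hσ.two_lie, wedge, hf]) (hf0 1)
  have h12 := heq ⁅f 1, f 2⁆ (μ • f 0)
    (by simp [Fin.forall_fin_succ, hσ.zero_lie, hσ.one_lie, hσ.two_lie, wedge, hf])
    (by rw [map_smul, LinearMap.smul_apply, hf0, smul_zero])
  have hjacobi := lie_jacobi (f 0) (f 1) (f 2)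
  rw [h01, h12, h20] at hjacobi
  simpa using congrArg (fun v => g.form v (b 0)) hjacobi

/-- The Jacobi identity for the dual frame reads `|χ|² = 0`, up to the factor `2 det D` with `D` the
matrix of the dual frame. -/
theorem IsMaurerCartan.form_lie_eq_zero (hσ : IsMaurerCartan (selfDualForm g b) μ)
    (hb : IsOrthonormal g b) (hσ0 : ∀ a, selfDualForm g b a (b 0) = 0)
    (hlie : ∀ x : 𝔤, ⁅x, b 0⁆ = g.form ⁅x, b 0⁆ (b 0) • b 0) {f : Fin 3 → 𝔤}
    (hf : ∀ a c, selfDualForm g b a (f c) = if a = c then 1 else 0)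
    (hf0 : ∀ c, g.form (f c) (b 0) = 0) (i : Fin 3) : g.form ⁅b i.succ, b 0⁆ (b 0) = 0 := by
  set D : Matrix (Fin 3) (Fin 3) ℝ := Matrix.of fun i c => g.form (f c) (b i.succ) with hD
  have hχf : ∀ c, g.form ⁅f c, b 0⁆ (b 0) = D 0 c * g.form ⁅b 1, b 0⁆ (b 0) +
      D 1 c * g.form ⁅b 2, b 0⁆ (b 0) + D 2 c * g.form ⁅b 3, b 0⁆ (b 0) := fun c => by
    conv_lhs => rw [← hb.sum_form_smul (f c)]
    simp [Fin.sum_univ_four, hf0, hD]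
  have hD1 : ∀ c, g.form (b 1) (f c) = D 0 c := fun c => g.symm _ _
  have hD2 : ∀ c, g.form (b 2) (f c) = D 1 c := fun c => g.symm _ _
  have hD3 : ∀ c, g.form (b 3) (f c) = D 2 c := fun c => g.symm _ _
  have hsum : D.det * ((g.form ⁅b 1, b 0⁆ (b 0)) ^ 2 + (g.form ⁅b 2, b 0⁆ (b 0)) ^ 2 +
      (g.form ⁅b 3, b 0⁆ (b 0)) ^ 2) = 0 := by
    have h := hσ.sum_form_lie_dual_mul hb hσ0 hf hf0
    simp only [fun a c => hb.form_lie_of_lie_eq_smul hσ0 hlie (f a) (f c), hf0, hχf, wedge, hD1,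
      hD2, hD3] at h
    rw [Matrix.det_fin_three]
    linear_combination h / 2
  have hsq := (mul_eq_zero.mp hsum).resolve_left (hb.det_dual_ne_zero hσ0 hf)
  refine pow_eq_zero_iff two_ne_zero |>.mp (le_antisymm ?_ (sq_nonneg _))
  have h1 := sq_nonneg (g.form ⁅b 1, b 0⁆ (b 0))
  have h2 := sq_nonneg (g.form ⁅b 2, b 0⁆ (b 0))
  have h3 := sq_nonneg (g.form ⁅b 3, b 0⁆ (b 0))
  fin_cases i
  · exact (show (g.form ⁅b 1, b 0⁆ (b 0)) ^ 2 ≤ 0 by linarith)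
  · exact (show (g.form ⁅b 2, b 0⁆ (b 0)) ^ 2 ≤ 0 by linarith)
  · exact (show (g.form ⁅b 3, b 0⁆ (b 0)) ^ 2 ≤ 0 by linarith)

theorem IsMaurerCartan.conn_eq_zero_of_dual (hσ : IsMaurerCartan (selfDualForm g b) μ)
    (hb : IsOrthonormal g b) (hσ0 : ∀ a, selfDualForm g b a (b 0) = 0) {f : Fin 3 → 𝔤}
    (hf : ∀ a c, selfDualForm g b a (f c) = if a = c then 1 else 0)
    (hf0 : ∀ c, g.form (f c) (b 0) = 0) (x : 𝔤) : conn g x (b 0) = 0 := by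
  have hlie : ∀ x : 𝔤, ⁅x, b 0⁆ = g.form ⁅x, b 0⁆ (b 0) • b 0 := fun x =>
    hb.eq_smul_of_dual hσ0 hf (hσ.apply_lie_eq_zero hσ0 x)
  have hχ := hσ.form_lie_eq_zero hb hσ0 hlie hf hf0
  have hcentral : ∀ x : 𝔤, ⁅x, b 0⁆ = 0 := fun x => by
    rw [hlie, ← hb.sum_form_smul x]
    simp [Fin.sum_univ_four, show g.form ⁅b 1, b 0⁆ (b 0) = 0 from hχ 0,
      show g.form ⁅b 2, b 0⁆ (b 0) = 0 from hχ 1, show g.form ⁅b 3, b 0⁆ (b 0) = 0 from hχ 2]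
  refine g.ext_form fun z => ?_
  have hcentral' : ∀ x : 𝔤, ⁅b 0, x⁆ = 0 := fun x => by rw [← lie_skew, hcentral, neg_zero]
  rw [conn_apply, form_nabla, hb.form_lie_of_lie_eq_smul hσ0 hlie]
  simp [hcentral, hcentral']

/-- If `b₀` is parallel then `[x, y] = σ(x) × y - σ(y) × x` on the orthogonal complement of `b₀`,
identified with `ℝ³`. -/
theorem IsOrthonormal.form_lie_of_parallel (hb : IsOrthonormal g b)
    (hpar : ∀ x, conn g x (b 0) = 0) (x y : 𝔤) :
    g.form ⁅x, y⁆ (b 1) = wedge (selfDualForm g b 1) (g.form (b 3)) x y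
        - wedge (selfDualForm g b 2) (g.form (b 2)) x y ∧
      g.form ⁅x, y⁆ (b 2) = wedge (selfDualForm g b 2) (g.form (b 1)) x y
        - wedge (selfDualForm g b 0) (g.form (b 3)) x y ∧
      g.form ⁅x, y⁆ (b 3) = wedge (selfDualForm g b 0) (g.form (b 2)) x y
        - wedge (selfDualForm g b 1) (g.form (b 1)) x y := by
  have hω : ∀ j, connForm g b 0 j = 0 := fun j => LinearMap.ext fun x => by
    rw [connForm_apply, hpar, map_zero, LinearMap.zero_apply, LinearMap.zero_apply]
  simp only [hb.form_lie_eq_connForm, Fin.sum_univ_four, selfDualForm_zero, selfDualForm_one,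
    selfDualForm_two, wedge, g.symm (b _), hω, connForm_self, connForm_skew g b 2 1,
    connForm_skew g b 3 1, connForm_skew g b 3 2, LinearMap.neg_apply, LinearMap.zero_apply]
  refine ⟨?_, ?_, ?_⟩ <;> ring

/-- With `D` the matrix of the dual frame `f`, torsion-freeness of the connection amounts to
`D * diagonal ![μ, 1, 1] = D.trace • 1 - Dᵀ`, whatever `μ`, which forces `D` to be skew-symmetric,
hence singular as it has odd size. -/
theorem IsMaurerCartan.false_of_parallel (hσ : IsMaurerCartan (selfDualForm g b) μ)
    (hb : IsOrthonormal g b) (hσ0 : ∀ a, selfDualForm g b a (b 0) = 0)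
    (hpar : ∀ x, conn g x (b 0) = 0) {f : Fin 3 → 𝔤}
    (hf : ∀ a c, selfDualForm g b a (f c) = if a = c then 1 else 0) : False := by
  set D : Matrix (Fin 3) (Fin 3) ℝ := Matrix.of fun i c => g.form (f c) (b i.succ)
  have hD1 : ∀ c, g.form (b 1) (f c) = D 0 c := fun c => g.symm _ _
  have hD2 : ∀ c, g.form (b 2) (f c) = D 1 c := fun c => g.symm _ _
  have hD3 : ∀ c, g.form (b 3) (f c) = D 2 c := fun c => g.symm _ _
  have hdual := hb.form_eq_sum_dual hσ0 hf
  have hdual1 : ∀ v, g.form v (b 1) = ∑ e, selfDualForm g b e v * D 0 e := fun v => hdual v 0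
  have hdual2 : ∀ v, g.form v (b 2) = ∑ e, selfDualForm g b e v * D 1 e := fun v => hdual v 1
  have hdual3 : ∀ v, g.form v (b 3) = ∑ e, selfDualForm g b e v * D 2 e := fun v => hdual v 2
  have htorsion := fun a c => hb.form_lie_of_parallel hpar (f a) (f c)
  simp only [hdual1, hdual2, hdual3, Fin.sum_univ_three, hσ.zero_lie, hσ.one_lie, hσ.two_lie,
    wedge, hf, hD1, hD2, hD3] at htorsion
  have h01 : D 0 2 = -D 2 0 ∧ D 1 2 = -D 2 1 ∧ D 2 2 = D 1 1 + D 0 0 := by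
    simpa using htorsion 0 1
  have h12 : μ * D 0 0 = D 2 2 + D 1 1 ∧ μ * D 1 0 = -D 0 1 ∧ μ * D 2 0 = -D 0 2 := by
    simpa using htorsion 1 2
  have h20 : D 0 1 = -D 1 0 ∧ D 1 1 = D 0 0 + D 2 2 ∧ D 2 1 = -D 1 2 := by
    simpa using htorsion 2 0
  have hdet : D.det = 0 := by
    have h0 : D 0 0 = 0 := by linarith
    have h2 : D 2 2 = 0 := by
      have h := h12.1
      rw [h0, mul_zero] at h
      linarith
    rw [Matrix.det_fin_three, h0, h2, show D 1 1 = 0 by linarith, h01.1, h20.1, h20.2.2]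
    ring
  exact hb.det_dual_ne_zero hσ0 hf hdet

theorem IsMaurerCartan.not_linearIndependent (hσ : IsMaurerCartan (selfDualForm g b) μ)
    (hb : IsOrthonormal g b) (hσ0 : ∀ a, selfDualForm g b a (b 0) = 0) :
    ¬LinearIndependent ℝ (selfDualForm g b) := by
  intro hli
  obtain ⟨f, hf⟩ := exists_dual_family hli
  have hf' : ∀ a c, selfDualForm g b a (f c - g.form (f c) (b 0) • b 0) =
      if a = c then 1 else 0 := fun a c => by
    rw [map_sub, map_smul, hσ0, smul_zero, sub_zero, hf]
  have hf0 : ∀ c, g.form (f c - g.form (f c) (b 0) • b 0) (b 0) = 0 := fun c => by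
    rw [map_sub, map_smul, LinearMap.sub_apply, LinearMap.smul_apply, hb, if_pos rfl, smul_eq_mul,
      mul_one, sub_self]
  exact hσ.false_of_parallel hb hσ0 (hσ.conn_eq_zero_of_dual hb hσ0 hf' hf0) hf'

end RankThree

section RankTwo

theorem lie_eq_zero_of_lie_eq_combination {𝔤 : Type*} [LieRing 𝔤] [LieAlgebra ℝ 𝔤]
    {x y z w : 𝔤} (hxy : LinearIndependent ℝ ![x, y]) {n₀ n₁ s t s' t' k c d : ℝ}
    (hk : k ≠ 0) (hn : ⁅x, y⁆ = n₀ • x + n₁ • y)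
    (hzx : ⁅z, x⁆ = s • x + t • y) (hzy : ⁅z, y⁆ = t • x - s • y)
    (hwx : ⁅w, x⁆ = s' • x + t' • y) (hwy : ⁅w, y⁆ = t' • x - s' • y)
    (hzw : ⁅z, w⁆ = k • ⁅x, y⁆ + c • z + d • w) : ⁅x, y⁆ = 0 := by
  by_contra hne
  -- `ad v` is traceless on the plane spanned by `x` and `y`, so it annihilates `⁅x, y⁆`.
  have hcommute : ∀ (v : 𝔤) (s t : ℝ), ⁅v, x⁆ = s • x + t • y → ⁅v, y⁆ = t • x - s • y →
      ⁅v, x⁆ = 0 ∧ ⁅v, y⁆ = 0 := fun v s t hvx hvy => by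
    have hvn : ⁅v, ⁅x, y⁆⁆ = 0 := by
      rw [leibniz_lie, hvx, hvy]
      simp
    rw [hn, lie_add, lie_smul, lie_smul, hvx, hvy] at hvn
    obtain ⟨h1, h2⟩ := LinearIndependent.pair_iff.mp hxy (n₀ * s + n₁ * t) (n₀ * t - n₁ * s)
      (by rw [← hvn]; module)
    have hs : (n₀ ^ 2 + n₁ ^ 2) * s = 0 := by linear_combination n₀ * h1 - n₁ * h2
    have ht : (n₀ ^ 2 + n₁ ^ 2) * t = 0 := by linear_combination n₁ * h1 + n₀ * h2
    have hnorm : n₀ ^ 2 + n₁ ^ 2 ≠ 0 := fun h => by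
      refine hne ?_
      rw [hn, show n₀ = 0 by nlinarith, show n₁ = 0 by nlinarith, zero_smul, zero_smul, add_zero]
    rw [hvx, hvy, (mul_eq_zero.mp hs).resolve_left hnorm, (mul_eq_zero.mp ht).resolve_left hnorm]
    simp
  obtain ⟨hzx0, hzy0⟩ := hcommute z s t hzx hzy
  obtain ⟨hwx0, hwy0⟩ := hcommute w s' t' hwx hwy
  have hcentral : ∀ v : 𝔤, ⁅z, v⁆ = 0 → ⁅w, v⁆ = 0 → ⁅⁅x, y⁆, v⁆ = 0 := fun v hzv hwv => by
    have h : ⁅⁅z, w⁆, v⁆ = 0 := by rw [lie_lie, hzv, hwv, lie_zero, lie_zero, sub_zero]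
    simpa [hzw, hzv, hwv, hk] using h
  have hx := hcentral x hzx0 hwx0
  have hy := hcentral y hzy0 hwy0
  rw [hn, add_lie, smul_lie, smul_lie, lie_self, smul_zero, zero_add, ← lie_skew, smul_neg,
    neg_eq_zero] at hx
  rw [hn, add_lie, smul_lie, smul_lie, lie_self, smul_zero, add_zero] at hy
  refine hne ?_
  rw [hn, (smul_eq_zero.mp hx).resolve_right hne, (smul_eq_zero.mp hy).resolve_right hne, zero_smul,
    zero_smul, add_zero]

variable {𝔤 : Type*} [LieRing 𝔤] [LieAlgebra ℝ 𝔤] [FiniteDimensional ℝ 𝔤] {g : Metric 𝔤}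
  {J : 𝔤 →ₗ[ℝ] 𝔤} {b : Module.Basis (Fin 4) ℝ 𝔤} {μ : ℝ}

theorem IsUnitary.selfDualForm_map_eq_zero (hb : IsUnitary g J b) (hR : IsAH1 g J) {p q : 𝔤}
    (hpq : wedge (selfDualForm g b 1) (selfDualForm g b 2) p q ≠ 0) {s t : ℝ}
    (hdep : selfDualForm g b 0 = s • selfDualForm g b 1 + t • selfDualForm g b 2) {x : 𝔤}
    (hx : ∀ a, selfDualForm g b a x = 0) (a : Fin 3) : selfDualForm g b a (J x) = 0 := by
  have hρ : ricciForm g b p q ≠ 0 := fun h => by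
    have hμ := (hb.isMaurerCartan hR hpq).scale_nonpos hpq hdep
    rw [h, zero_div, sub_zero] at hμ
    exact absurd hμ (by norm_num)
  have hρx : ∀ y, ricciForm g b x y = 0 := fun y => by
    have h := hb.wedge_mul_ricciForm hR p q x y
    rw [wedge, wedge, hx, hx, zero_mul, mul_zero, sub_zero, mul_zero] at h
    exact (mul_eq_zero.mp h).resolve_left hpq
  have hρJx : ∀ y, ricciForm g b (J x) y = 0 := fun y => by
    have h := hR.ricciForm_map_map b x (-J y)
    rwa [map_neg, hb.isCompatible.sq, neg_neg, hρx] at h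
  have hWJx : ∀ y, wedge (selfDualForm g b 1) (selfDualForm g b 2) (J x) y = 0 := fun y => by
    have h := hb.wedge_mul_ricciForm hR p q (J x) y
    rw [hρJx, mul_zero] at h
    exact (mul_eq_zero.mp h.symm).resolve_left hρ
  obtain ⟨h1, h2⟩ := eq_zero_of_forall_wedge_eq_zero hpq hWJx
  have h0 : selfDualForm g b 0 (J x) = 0 := by
    rw [hdep, LinearMap.add_apply, LinearMap.smul_apply, LinearMap.smul_apply, h1, h2, smul_zero,
      smul_zero, add_zero]
  fin_cases a
  exacts [h0, h1, h2]

theorem IsMaurerCartan.form_lie_eq_zero_of_wedge_ne_zero (hσ : IsMaurerCartan (selfDualForm g b) μ)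
    (hb : IsOrthonormal g b) (hσ0 : ∀ a, selfDualForm g b a (b 0) = 0)
    (hσ1 : ∀ a, selfDualForm g b a (b 1) = 0)
    (hW : wedge (selfDualForm g b 1) (selfDualForm g b 2) (b 2) (b 3) ≠ 0) {y : 𝔤}
    (hy : ∀ a, selfDualForm g b a y = 0) (x : 𝔤) :
    g.form ⁅x, y⁆ (b 2) = 0 ∧ g.form ⁅x, y⁆ (b 3) = 0 := by
  have h := hσ.apply_lie_eq_zero hy x
  have hsum : ∀ a, g.form ⁅x, y⁆ (b 2) * selfDualForm g b a (b 2) +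
      g.form ⁅x, y⁆ (b 3) * selfDualForm g b a (b 3) = 0 := fun a => by
    have hexp := hb.dual_apply_eq_sum (selfDualForm g b a) ⁅x, y⁆
    simpa [Fin.sum_univ_four, hσ0, hσ1, h] using hexp.symm
  unfold wedge at hW
  constructor <;> refine (mul_eq_zero.mp ?_).resolve_right hW
  · linear_combination selfDualForm g b 2 (b 3) * hsum 1 - selfDualForm g b 1 (b 3) * hsum 2
  · linear_combination selfDualForm g b 1 (b 2) * hsum 2 - selfDualForm g b 2 (b 2) * hsum 1

theorem structConst_of_selfDualForm_eq_zero {b : Fin 4 → 𝔤}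
    (hσ0 : ∀ a, selfDualForm g b a (b 0) = 0) (hσ1 : ∀ a, selfDualForm g b a (b 1) = 0)
    (hK : ∀ i, structConst g b i 0 2 = 0 ∧ structConst g b i 0 3 = 0 ∧
      structConst g b i 1 2 = 0 ∧ structConst g b i 1 3 = 0) :
    structConst g b 2 3 0 = -2 * structConst g b 0 1 0 ∧
      structConst g b 2 3 1 = -2 * structConst g b 0 1 1 ∧
      structConst g b 2 0 0 + structConst g b 2 1 1 = 0 ∧
      structConst g b 3 0 0 + structConst g b 3 1 1 = 0 := by
  have h00 := two_mul_selfDualForm_zero g b 0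
  have h01 := two_mul_selfDualForm_zero g b 1
  have h10 := two_mul_selfDualForm_one g b 0
  have h11 := two_mul_selfDualForm_one g b 1
  have h20 := two_mul_selfDualForm_two g b 0
  have h21 := two_mul_selfDualForm_two g b 1
  simp only [hσ0, hσ1, structConst_self, structConst_skew g b 0 2, structConst_skew g b 0 3,
    structConst_skew g b 1 2, structConst_skew g b 1 3, structConst_skew g b 1 0, hK]
    at h00 h01 h10 h11 h20 h21
  refine ⟨?_, ?_, ?_, ?_⟩ <;> linarith

theorem selfDualForm_eq_of_structConst {b : Fin 4 → 𝔤}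
    (hK : ∀ i, structConst g b i 0 2 = 0 ∧ structConst g b i 0 3 = 0 ∧
      structConst g b i 1 2 = 0 ∧ structConst g b i 1 3 = 0)
    (h0 : structConst g b 2 3 0 = -2 * structConst g b 0 1 0)
    (h1 : structConst g b 2 3 1 = -2 * structConst g b 0 1 1) :
    2 * selfDualForm g b 0 (b 2) =
        structConst g b 2 0 1 - structConst g b 2 1 0 - 2 * structConst g b 2 3 2 ∧
      2 * selfDualForm g b 0 (b 3) =
        structConst g b 3 0 1 - structConst g b 3 1 0 - 2 * structConst g b 2 3 3 ∧
      selfDualForm g b 1 (b 2) = -structConst g b 0 1 1 ∧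
      selfDualForm g b 1 (b 3) = -structConst g b 0 1 0 ∧
      selfDualForm g b 2 (b 2) = structConst g b 0 1 0 ∧
      selfDualForm g b 2 (b 3) = -structConst g b 0 1 1 := by
  have h02 := two_mul_selfDualForm_zero g b 2
  have h03 := two_mul_selfDualForm_zero g b 3
  have h12 := two_mul_selfDualForm_one g b 2
  have h13 := two_mul_selfDualForm_one g b 3
  have h22 := two_mul_selfDualForm_two g b 2
  have h23 := two_mul_selfDualForm_two g b 3
  simp only [structConst_self, structConst_skew g b 0 2, structConst_skew g b 0 3,
    structConst_skew g b 1 2, structConst_skew g b 1 3, structConst_skew g b 3 2, hK, h0, h1]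
    at h02 h03 h12 h13 h22 h23
  refine ⟨?_, ?_, ?_, ?_, ?_, ?_⟩ <;> linarith

theorem IsMaurerCartan.structConst_symm (hσ : IsMaurerCartan (selfDualForm g b) μ)
    (hb : IsOrthonormal g b) (hσ0 : ∀ a, selfDualForm g b a (b 0) = 0)
    (hσ1 : ∀ a, selfDualForm g b a (b 1) = 0)
    (hK : ∀ i, structConst g b i 0 2 = 0 ∧ structConst g b i 0 3 = 0 ∧
      structConst g b i 1 2 = 0 ∧ structConst g b i 1 3 = 0)
    (hne : structConst g b 0 1 0 ^ 2 + structConst g b 0 1 1 ^ 2 ≠ 0) :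
    structConst g b 2 1 0 = structConst g b 2 0 1 ∧
      structConst g b 3 1 0 = structConst g b 3 0 1 := by
  obtain ⟨h230, h231, -, -⟩ := structConst_of_selfDualForm_eq_zero hσ0 hσ1 hK
  obtain ⟨hσ02, hσ03, hσ12, hσ13, hσ22, hσ23⟩ := selfDualForm_eq_of_structConst hK h230 h231
  have h1 := hσ.one_lie (b 2) (b 3)
  have h2 := hσ.two_lie (b 2) (b 3)
  rw [hb.lie_eq_sum_structConst, Fin.sum_univ_four] at h1 h2
  simp only [wedge, map_add, map_smul, smul_eq_mul, hσ0, hσ1, hσ12, hσ13, hσ22, hσ23] at h1 h2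
  have h1' : structConst g b 0 1 1 * (structConst g b 2 1 0 - structConst g b 2 0 1) +
      structConst g b 0 1 0 * (structConst g b 3 1 0 - structConst g b 3 0 1) = 0 := by
    linear_combination 2 * h1 + structConst g b 0 1 1 * hσ02 + structConst g b 0 1 0 * hσ03
  have h2' : structConst g b 0 1 1 * (structConst g b 3 1 0 - structConst g b 3 0 1) -
      structConst g b 0 1 0 * (structConst g b 2 1 0 - structConst g b 2 0 1) = 0 := by
    linear_combination 2 * h2 + structConst g b 0 1 1 * hσ03 - structConst g b 0 1 0 * hσ02
  constructor <;> refine mul_left_cancel₀ hne ?_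
  · linear_combination structConst g b 0 1 1 * h1' - structConst g b 0 1 0 * h2'
  · linear_combination structConst g b 0 1 0 * h1' + structConst g b 0 1 1 * h2'

theorem IsMaurerCartan.wedge_eq_zero_of_selfDualForm_eq_zero
    (hσ : IsMaurerCartan (selfDualForm g b) μ) (hb : IsOrthonormal g b)
    (hσ0 : ∀ a, selfDualForm g b a (b 0) = 0) (hσ1 : ∀ a, selfDualForm g b a (b 1) = 0) :
    wedge (selfDualForm g b 1) (selfDualForm g b 2) (b 2) (b 3) = 0 := by
  by_contra hW
  have hK : ∀ i, structConst g b i 0 2 = 0 ∧ structConst g b i 0 3 = 0 ∧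
      structConst g b i 1 2 = 0 ∧ structConst g b i 1 3 = 0 := fun i => by
    have h0 := hσ.form_lie_eq_zero_of_wedge_ne_zero hb hσ0 hσ1 hW hσ0 (b i)
    have h1 := hσ.form_lie_eq_zero_of_wedge_ne_zero hb hσ0 hσ1 hW hσ1 (b i)
    exact ⟨h0.1, h0.2, h1⟩
  obtain ⟨h230, h231, htr2, htr3⟩ := structConst_of_selfDualForm_eq_zero hσ0 hσ1 hK
  obtain ⟨-, -, hσ12, hσ13, hσ22, hσ23⟩ := selfDualForm_eq_of_structConst hK h230 h231
  have hne : structConst g b 0 1 0 ^ 2 + structConst g b 0 1 1 ^ 2 ≠ 0 := by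
    convert hW using 1
    rw [wedge, hσ12, hσ13, hσ22, hσ23]
    ring
  obtain ⟨hsymm2, hsymm3⟩ := hσ.structConst_symm hb hσ0 hσ1 hK hne
  have hlie := hb.lie_eq_sum_structConst
  simp only [Fin.sum_univ_four] at hlie
  have hli : LinearIndependent ℝ ![b 0, b 1] := by
    convert b.linearIndependent.comp ![0, 1] (by decide) using 1
    ext i
    fin_cases i <;> rfl
  have habelian : ⁅b 0, b 1⁆ = 0 := by
    refine lie_eq_zero_of_lie_eq_combination (z := b 2) (w := b 3) hli (k := -2) (by norm_num)
      (n₀ := structConst g b 0 1 0) (n₁ := structConst g b 0 1 1) (s := structConst g b 2 0 0)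
      (t := structConst g b 2 0 1) (s' := structConst g b 3 0 0) (t' := structConst g b 3 0 1)
      (c := structConst g b 2 3 2) (d := structConst g b 2 3 3) ?_ ?_ ?_ ?_ ?_ ?_ <;> rw [hlie]
    · simp [hK]
    · simp [hK]
    · rw [hsymm2, eq_neg_of_add_eq_zero_right htr2]
      simp [hK, sub_eq_add_neg]
    · simp [hK]
    · rw [hsymm3, eq_neg_of_add_eq_zero_right htr3]
      simp [hK, sub_eq_add_neg]
    · rw [hlie 0 1, h230, h231]
      simp [hK, mul_smul]
  refine hne ?_
  simp [structConst, habelian]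

end RankTwo

section Reduction

variable {𝔤 : Type*} [LieRing 𝔤] [LieAlgebra ℝ 𝔤] [FiniteDimensional ℝ 𝔤] {g : Metric 𝔤}
  {J : 𝔤 →ₗ[ℝ] 𝔤}

namespace IsUnitary

variable {b : Module.Basis (Fin 4) ℝ 𝔤}

theorem wedge_selfDualForm_eq_zero (hb : IsUnitary g J b) (hR : IsAH1 g J)
    (hσ0 : ∀ a, selfDualForm g b a (b 0) = 0) (x y : 𝔤) :
    wedge (selfDualForm g b 1) (selfDualForm g b 2) x y = 0 := by
  by_contra hxy
  have hσ := hb.isMaurerCartan hR hxy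
  rcases linearIndependent_or_eq_combination hxy with hli | ⟨s, t, hdep⟩
  · exact hσ.not_linearIndependent hb.ortho hσ0 hli
  have hσ1 : ∀ a, selfDualForm g b a (b 1) = 0 := fun a => by
    rw [← hb.map0, hb.selfDualForm_map_eq_zero hR hxy hdep hσ0]
  have h23 := hσ.wedge_eq_zero_of_selfDualForm_eq_zero hb.ortho hσ0 hσ1
  refine hxy ?_
  have hexp : ∀ a z, selfDualForm g b a z =
      g.form z (b 2) * selfDualForm g b a (b 2) + g.form z (b 3) * selfDualForm g b a (b 3) :=
    fun a z => by
      have h := hb.ortho.dual_apply_eq_sum (selfDualForm g b a) z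
      rwa [Fin.sum_univ_four, hσ0, hσ1, mul_zero, mul_zero, add_zero, zero_add] at h
  rw [wedge, hexp 1 x, hexp 2 x, hexp 1 y, hexp 2 y]
  rw [wedge] at h23
  linear_combination (g.form x (b 2) * g.form y (b 3) - g.form x (b 3) * g.form y (b 2)) * h23

theorem form_lie_eq_zero_and_selfDualForm_zero_eq_zero (hb : IsUnitary g J b) (hR : IsAH1 g J)
    (hker : ∀ x, g.form (b 0) x = 0 → selfDualForm g b 1 x = 0 ∧ selfDualForm g b 2 x = 0)
    (hK : ¬IsKahler g J) :
    (∀ x y : 𝔤, g.form ⁅x, y⁆ (b 0) = 0) ∧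
      ∀ x, g.form (b 0) x = 0 → selfDualForm g b 0 x = 0 := by
  have hb0 : g.form (b 0) (b 0) = 1 := by rw [hb.ortho, if_pos rfl]
  have hprop : ∀ x, selfDualForm g b 1 x = g.form (b 0) x * selfDualForm g b 1 (b 0) ∧
      selfDualForm g b 2 x = g.form (b 0) x * selfDualForm g b 2 (b 0) := fun x => by
    have h := hker (x - g.form (b 0) x • b 0)
      (by rw [map_sub, map_smul, hb0, smul_eq_mul, mul_one, sub_self])
    simpa only [map_sub, map_smul, smul_eq_mul, sub_eq_zero] using h
  set s := selfDualForm g b 1 (b 0)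
  set t := selfDualForm g b 2 (b 0)
  have hst : s ^ 2 + t ^ 2 ≠ 0 := fun h => by
    have hs : s = 0 := by nlinarith
    have ht : t = 0 := by nlinarith
    refine hK (hb.isKahler ?_ ?_) <;> ext x
    · rw [(hprop x).1, hs, mul_zero, LinearMap.zero_apply]
    · rw [(hprop x).2, ht, mul_zero, LinearMap.zero_apply]
  have h1 := hb.selfDualForm_one_lie hR
  have h2 := hb.selfDualForm_two_lie hR
  simp only [wedge, hprop] at h1 h2
  constructor
  · intro x y
    rw [g.symm]
    refine (mul_eq_zero.mp ?_).resolve_left hst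
    linear_combination s * h1 x y + t * h2 x y
  · intro x hx
    refine (mul_eq_zero.mp ?_).resolve_left hst
    have h1x := h1 (b 0) x
    have h2x := h2 (b 0) x
    rw [hx, hb0] at h1x h2x
    linear_combination s * h2x - t * h1x

theorem conn_eq_zero_of_orthogonal (hb : IsUnitary g J b) (hR : IsAH1 g J)
    (hker : ∀ x, g.form (b 0) x = 0 → selfDualForm g b 1 x = 0 ∧ selfDualForm g b 2 x = 0)
    (hK : ¬IsKahler g J) :
    (∀ x, conn g x (b 0) = 0) ∧ ∀ x, g.form (b 0) x = 0 → conn g x = 0 := by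
  obtain ⟨hlie, hσ⟩ := hb.form_lie_eq_zero_and_selfDualForm_zero_eq_zero hR hker hK
  have hρ : ricciForm g b (b 0) (b 1) = 0 := by
    have h := hb.ortho.selfDualForm_zero_lie (b 0) (b 1)
    have hb1 := hker (b 1) (by rw [hb.ortho, if_neg (by decide)])
    rw [hσ _ (by rw [g.symm, hlie]), wedge, hb1.1, hb1.2] at h
    linarith
  have hb0 := conn_eq_zero_of_sum_curvatureTensor_eq_zero hb.ortho hlie
    (by rw [hb.sum_curvatureTensor_eq_ricciForm hR, hρ])
  refine ⟨hb0, fun x hx => ?_⟩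
  have h0j : ∀ j, connForm g b 0 j x = 0 := fun j => by
    rw [connForm_apply, hb0, map_zero, LinearMap.zero_apply]
  have h23 := hσ x hx
  obtain ⟨h13, h12⟩ := hker x hx
  rw [selfDualForm_zero, h0j, zero_add] at h23
  rw [selfDualForm_one, h0j, zero_sub, neg_eq_zero] at h13
  rw [selfDualForm_two, h0j, zero_add] at h12
  refine b.ext fun i => hb.ortho.ext_form fun j => ?_
  rw [← connForm_apply, LinearMap.zero_apply, map_zero, LinearMap.zero_apply]
  fin_cases i <;> fin_cases j <;>
    simp [h0j, h12, h13, h23, connForm_self, connForm_skew g b _ 0, connForm_skew g b 2 1,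
      connForm_skew g b 3 1, connForm_skew g b 3 2]

end IsUnitary

theorem exists_isUnitary_selfDualForm_eq_zero (hdim : Module.finrank ℝ 𝔤 = 4)
    (hJ : IsCompatible g J) :
    ∃ b, IsUnitary g J b ∧ ∀ a, selfDualForm g b a (b 0) = 0 := by
  obtain ⟨v, hv, -⟩ := g.exists_unit_forall_eq_zero ![] (by simp [hdim])
  obtain ⟨c, hc, -⟩ := exists_isUnitary hdim hJ hv
  obtain ⟨w, hw, hσw⟩ := g.exists_unit_forall_eq_zero (selfDualForm g c) (by simp [hdim])
  obtain ⟨b, hb, rfl⟩ := exists_isUnitary hdim hJ hw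
  exact ⟨b, hb, (hb.forall_selfDualForm_eq_zero_iff _).mpr
    ((hc.forall_selfDualForm_eq_zero_iff _).mp hσw)⟩

theorem exists_isUnitary_orthogonal_le_ker (hdim : Module.finrank ℝ 𝔤 = 4)
    (hJ : IsCompatible g J) (hR : IsAH1 g J) (hK : ¬IsKahler g J) :
    ∃ b, IsUnitary g J b ∧
      ∀ x, g.form (b 0) x = 0 → selfDualForm g b 1 x = 0 ∧ selfDualForm g b 2 x = 0 := by
  obtain ⟨c, hc, hσc⟩ := exists_isUnitary_selfDualForm_eq_zero hdim hJ
  have hne : selfDualForm g c 1 ≠ 0 ∨ selfDualForm g c 2 ≠ 0 := by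
    by_contra! h
    exact hK (hc.isKahler h.1 h.2)
  obtain ⟨u, hu, hker⟩ :=
    g.exists_unit_orthogonal_le_ker_of_wedge (hc.wedge_selfDualForm_eq_zero hR hσc) hne
  obtain ⟨b, hb, rfl⟩ := exists_isUnitary hdim hJ hu
  exact ⟨b, hb, fun x hx =>
    (hb.isParallelAlong_iff x).mp ((hc.isParallelAlong_iff x).mpr (hker x hx))⟩

theorem exists_conn_eq_smul (hdim : Module.finrank ℝ 𝔤 = 4) (hJ : IsCompatible g J)
    (hR : IsAH1 g J) (hK : ¬IsKahler g J) :
    ∃ u, g.form u u = 1 ∧ conn g u u = 0 ∧ conn g u ≠ 0 ∧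
      ∀ x y, conn g x y = g.form u x • conn g u y := by
  obtain ⟨b, hb, hker⟩ := exists_isUnitary_orthogonal_le_ker hdim hJ hR hK
  obtain ⟨hb0, hconn⟩ := hb.conn_eq_zero_of_orthogonal hR hker hK
  have hnorm : g.form (b 0) (b 0) = 1 := by rw [hb.ortho, if_pos rfl]
  have hsmul : ∀ x y, conn g x y = g.form (b 0) x • conn g (b 0) y := fun x y => by
    have h := hconn (x - g.form (b 0) x • b 0)
      (by rw [map_sub, map_smul, hnorm, smul_eq_mul, mul_one, sub_self])
    rw [map_sub, map_smul, sub_eq_zero] at h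
    rw [h, LinearMap.smul_apply]
  refine ⟨b 0, hnorm, hb0 _, fun h => hK (isKahler_of_parallel hJ fun x y => ?_), hsmul⟩
  rw [hsmul x y, hsmul x (J y), h, LinearMap.zero_apply, LinearMap.zero_apply, smul_zero, map_zero]

end Reduction

section Classification

section SkewEndomorphisms

variable {V : Type*} [AddCommGroup V] [Module ℝ V] [FiniteDimensional ℝ V] {g : Metric V}
  {A : V →ₗ[ℝ] V} {u : V}

theorem exists_unit_orthogonal_apply_eq_zero (hV : Module.finrank ℝ V = 4)
    (hA : ∀ x y, g.form (A x) y = -g.form (A y) x) (hu : g.form u u = 1) (hAu : A u = 0) :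
    ∃ v, g.form v v = 1 ∧ g.form u v = 0 ∧ A v = 0 := by
  have hself : ∀ x, g.form (A x) x = 0 := fun x => by linarith [hA x x]
  obtain ⟨w, hw, huw⟩ := g.exists_unit_forall_eq_zero ![g.form u] (by simp [hV])
  obtain ⟨b, hb, rfl, rfl⟩ := exists_isOrthonormal_apply_eq hV g hu hw (huw 0)
  have hA0 : ∀ x, g.form (A x) (b 0) = 0 := fun x => by
    rw [hA, hAu, map_zero, LinearMap.zero_apply, neg_zero]
  -- the axis of the skew endomorphism which `A` induces on the orthogonal complement of `u`
  set v := g.form (A (b 2)) (b 3) • b 1 - g.form (A (b 1)) (b 3) • b 2 +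
    g.form (A (b 1)) (b 2) • b 3 with hv
  rcases eq_or_ne v 0 with hv0 | hv0
  · have h := fun i => congrArg (fun x => g.form x (b i)) (hv.symm.trans hv0)
    have h12 : g.form (A (b 1)) (b 2) = 0 := by simpa [hb _ _] using h 3
    have h13 : g.form (A (b 1)) (b 3) = 0 := by simpa [hb _ _] using h 2
    refine ⟨b 1, hw, huw 0, hb.ext_form fun i => ?_⟩
    fin_cases i <;> simp [hA0, hself, h12, h13]
  · have hAv : A v = 0 := hb.ext_form fun i => by
      fin_cases i <;>
        simp [hv, hA0, hself, hA (b 2) (b 1), hA (b 3) (b 1), hA (b 3) (b 2)] <;> ring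
    have huv : g.form (b 0) v = 0 := by simp [hv, hb _ _]
    obtain ⟨r, -, hr⟩ := g.exists_smul_unit hv0
    exact ⟨r • v, hr, by rw [map_smul, huv, smul_zero], by rw [map_smul, hAv, smul_zero]⟩

theorem exists_isOrthonormal_of_skew (hV : Module.finrank ℝ V = 4)
    (hA : ∀ x y, g.form (A x) y = -g.form (A y) x) (hA0 : A ≠ 0) (hu : g.form u u = 1)
    (hAu : A u = 0) :
    ∃ (b : Module.Basis (Fin 4) ℝ V) (l : ℝ), IsOrthonormal g b ∧ l ≠ 0 ∧
      b 0 = u ∧ A (b 1) = 0 ∧ A (b 2) = l • b 3 ∧ A (b 3) = -l • b 2 := by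
  have hself : ∀ x, g.form (A x) x = 0 := fun x => by linarith [hA x x]
  obtain ⟨v, hv, huv, hAv⟩ := exists_unit_orthogonal_apply_eq_zero hV hA hu hAu
  obtain ⟨b, hb, rfl, rfl⟩ := exists_isOrthonormal_apply_eq hV g hu hv huv
  have h0 : ∀ x, g.form (A x) (b 0) = 0 := fun x => by
    rw [hA, hAu, map_zero, LinearMap.zero_apply, neg_zero]
  have h1 : ∀ x, g.form (A x) (b 1) = 0 := fun x => by
    rw [hA, hAv, map_zero, LinearMap.zero_apply, neg_zero]
  set l := g.form (A (b 2)) (b 3) with hl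
  have hA2 : A (b 2) = l • b 3 := hb.ext_form fun i => by
    fin_cases i <;> simp [h0, h1, hself, hb _ _, hl]
  have hA3 : A (b 3) = -l • b 2 := hb.ext_form fun i => by
    fin_cases i <;> simp [h0, h1, hself, hb _ _, hl, hA (b 3) (b 2)]
  refine ⟨b, l, hb, fun hl0 => hA0 (b.ext fun i => ?_), rfl, hAv, hA2, hA3⟩
  fin_cases i <;> simp [hAu, hAv, hA2, hA3, hl0]

end SkewEndomorphisms

theorem A36A1.nonempty_lieEquiv {𝔤 : Type*} [LieRing 𝔤] [LieAlgebra ℝ 𝔤]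
    (e : Module.Basis (Fin 4) ℝ 𝔤) (h01 : ⁅e 0, e 1⁆ = 0) (h02 : ⁅e 0, e 2⁆ = -e 1)
    (h12 : ⁅e 1, e 2⁆ = e 0) (h3 : ∀ i, ⁅e i, e 3⁆ = 0) : Nonempty (𝔤 ≃ₗ⁅ℝ⁆ A36A1) := by
  let f := e.equivFun.trans A36A1.coordEquiv.symm
  have hf : ∀ x, f x = ⟨e.equivFun x 0, e.equivFun x 1, e.equivFun x 2, e.equivFun x 3⟩ :=
    fun _ => rfl
  have hf0 : f (e 0) = ⟨1, 0, 0, 0⟩ := by simp [hf]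
  have hf1 : f (e 1) = ⟨0, 1, 0, 0⟩ := by simp [hf]
  have hf2 : f (e 2) = ⟨0, 0, 1, 0⟩ := by simp [hf]
  have hf3 : f (e 3) = ⟨0, 0, 0, 1⟩ := by simp [hf]
  have h10 : ⁅e 1, e 0⁆ = 0 := by rw [← lie_skew, h01, neg_zero]
  have h20 : ⁅e 2, e 0⁆ = e 1 := by rw [← lie_skew, h02, neg_neg]
  have h21 : ⁅e 2, e 1⁆ = -e 0 := by rw [← lie_skew, h12]
  have h3' : ∀ i, ⁅e 3, e i⁆ = 0 := fun i => by rw [← lie_skew, h3, neg_zero]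
  have hlie : (LieModule.toEnd ℝ 𝔤 𝔤 : 𝔤 →ₗ[ℝ] 𝔤 →ₗ[ℝ] 𝔤).compr₂ (f : 𝔤 →ₗ[ℝ] A36A1) =
      (LieModule.toEnd ℝ A36A1 A36A1 : A36A1 →ₗ[ℝ] A36A1 →ₗ[ℝ] A36A1).compl₁₂
        (f : 𝔤 →ₗ[ℝ] A36A1) (f : 𝔤 →ₗ[ℝ] A36A1) := e.ext fun i => e.ext fun j => by
    fin_cases i <;> fin_cases j <;>
      simp [h01, h02, h12, h3, h10, h20, h21, h3', hf0, hf1, hf2, hf3, A36A1.lie_def,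
        A36A1.zero_def, A36A1.neg_def]
  exact ⟨{ f with map_lie' := fun {x y} => LinearMap.congr_fun₂ hlie x y }⟩

variable {𝔤 : Type*} [LieRing 𝔤] [LieAlgebra ℝ 𝔤] [FiniteDimensional ℝ 𝔤] {g : Metric 𝔤}

theorem A36A1.nonempty_lieEquiv_of_conn_eq_smul (hdim : Module.finrank ℝ 𝔤 = 4) {u : 𝔤}
    (hu : g.form u u = 1) (huu : conn g u u = 0) (hne : conn g u ≠ 0)
    (h : ∀ x y, conn g x y = g.form u x • conn g u y) : Nonempty (𝔤 ≃ₗ⁅ℝ⁆ A36A1) := by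
  obtain ⟨b, l, hb, hl, rfl, h1, h2, h3⟩ :=
    exists_isOrthonormal_of_skew hdim (form_conn_left g u) hne hu huu
  have hlie : ∀ i j, ⁅b i, b j⁆ = (if 0 = i then conn g (b 0) (b j) else 0) -
      if 0 = j then conn g (b 0) (b i) else 0 := fun i j => by
    rw [lie_eq_conn g, h (b i), h (b j), hb, hb, ite_smul, ite_smul]
    simp only [one_smul, zero_smul]
  let c := b.unitsSMul ![(Units.mk0 l hl)⁻¹, 1, 1, 1]
  have hc0 : c 0 = l⁻¹ • b 0 := by simp [c, Module.Basis.unitsSMul_apply, Units.smul_def]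
  have hc : ∀ i : Fin 3, c i.succ = b i.succ := fun i => by
    fin_cases i <;> simp [c, Module.Basis.unitsSMul_apply]
  have hc1 : c 1 = b 1 := hc 0
  have hc2 : c 2 = b 2 := hc 1
  have hc3 : c 3 = b 3 := hc 2
  let e := c.reindex (Equiv.addRight 2)
  have he0 : e 0 = b 2 := (c.reindex_apply _ 0).trans hc2
  have he1 : e 1 = b 3 := (c.reindex_apply _ 1).trans hc3
  have he2 : e 2 = l⁻¹ • b 0 := (c.reindex_apply _ 2).trans hc0
  have he3 : e 3 = b 1 := (c.reindex_apply _ 3).trans hc1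
  refine A36A1.nonempty_lieEquiv e ?_ ?_ ?_ fun i => ?_
  · simp [he0, he1, hlie]
  · simp [he0, he1, he2, hlie, h2, hl]
  · simp [he0, he1, he2, hlie, h3, hl]
  · fin_cases i <;> simp [he0, he1, he2, he3, hlie, h1]

variable {J : 𝔤 →ₗ[ℝ] 𝔤}

theorem IsAH1.isFlat (hdim : Module.finrank ℝ 𝔤 = 4) (hJ : IsCompatible g J) (hR : IsAH1 g J)
    (hK : ¬IsKahler g J) : IsFlat g := by
  obtain ⟨u, -, huu, -, h⟩ := exists_conn_eq_smul hdim hJ hR hK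
  exact isFlat_of_conn_eq_smul huu h

theorem IsAH1.nonempty_lieEquiv (hdim : Module.finrank ℝ 𝔤 = 4) (hJ : IsCompatible g J)
    (hR : IsAH1 g J) (hK : ¬IsKahler g J) : Nonempty (𝔤 ≃ₗ⁅ℝ⁆ A36A1) := by
  obtain ⟨u, hu, huu, hne, h⟩ := exists_conn_eq_smul hdim hJ hR hK
  exact A36A1.nonempty_lieEquiv_of_conn_eq_smul hdim hu huu hne h

theorem IsFlat.isAH1 (hg : IsFlat g) (J : 𝔤 →ₗ[ℝ] 𝔤) : IsAH1 g J := fun x y z w => by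
  rw [curvatureTensor, curvatureTensor, hg, hg, map_zero, LinearMap.zero_apply,
    LinearMap.zero_apply]

end Classification

section NonKahler

variable {𝔤 : Type*} [LieRing 𝔤] [LieAlgebra ℝ 𝔤] [FiniteDimensional ℝ 𝔤]

theorem exists_isCompatible_not_isKahler (hdim : Module.finrank ℝ 𝔤 = 4) (g : Metric 𝔤)
    {x y z : 𝔤} (hz : z ≠ 0) (hcen : ∀ w : 𝔤, ⁅w, z⁆ = 0) (hxy : ∀ r : ℝ, ⁅x, y⁆ ≠ r • z) :
    ∃ J : 𝔤 →ₗ[ℝ] 𝔤, IsCompatible g J ∧ ¬IsKahler g J := by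
  obtain ⟨u, hu, r, hu_def⟩ : ∃ u, g.form u u = 1 ∧ ∃ r : ℝ, u = r • z :=
    let ⟨r, _, hr⟩ := g.exists_smul_unit hz
    ⟨r • z, hr, r, rfl⟩
  have hcu : ∀ w : 𝔤, ⁅w, u⁆ = 0 := fun w => by rw [hu_def, lie_smul, hcen, smul_zero]
  have hp0 : ⁅x, y⁆ - g.form ⁅x, y⁆ u • u ≠ 0 := by
    rw [sub_ne_zero, hu_def, smul_smul]
    exact hxy _
  obtain ⟨v, hv, q, hv_def⟩ : ∃ v, g.form v v = 1 ∧
      ∃ q : ℝ, v = q • (⁅x, y⁆ - g.form ⁅x, y⁆ u • u) :=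
    let ⟨q, _, hq⟩ := g.exists_smul_unit hp0
    ⟨_, hq, q, rfl⟩
  have huv : g.form u v = 0 := by simp [hv_def, hu, g.symm u ⁅x, y⁆]
  have hxyv : g.form ⁅x, y⁆ v ≠ 0 := fun h => by
    have hvv := congrArg (g.form · v) hv_def
    simp [hv, h, huv] at hvv
  obtain ⟨J, hJ, hJu⟩ := exists_isCompatible_apply_eq hdim g hu hv huv
  refine ⟨J, hJ, fun hK => hxyv ?_⟩
  have hd := hK.2 x y u
  rw [dOmega, hcu, ← lie_skew u x, hcu, neg_zero, omega, omega, omega, hJ.form_left, hJu] at hd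
  simpa using hd

end NonKahler

namespace A36A1

theorem nabla_stdMetric (x y : A36A1) :
    nabla stdMetric x y = ⟨-(x.c3 * y.c2), x.c3 * y.c1, 0, 0⟩ := by
  refine stdMetric.ext_form fun z => ?_
  rw [form_nabla]
  simp only [stdMetric, LinearMap.mk₂_apply, lie_def]
  ring

theorem isFlat_stdMetric : IsFlat stdMetric := fun x y z => by
  simp only [curvature, nabla_stdMetric, lie_def, sub_eq_add_neg, neg_def, add_def]
  ext <;> simp only [zero_def] <;> ring

theorem exists_isCompatible_not_isKahler {𝔤 : Type*} [LieRing 𝔤] [LieAlgebra ℝ 𝔤]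
    [FiniteDimensional ℝ 𝔤] (e : 𝔤 ≃ₗ⁅ℝ⁆ A36A1) (g : Metric 𝔤) :
    ∃ J : 𝔤 →ₗ[ℝ] 𝔤, IsCompatible g J ∧ ¬IsKahler g J := by
  refine LieAH.exists_isCompatible_not_isKahler (e.toLinearEquiv.finrank_eq.trans finrank_eq) g
    (x := e.symm ⟨0, 1, 0, 0⟩) (y := e.symm ⟨0, 0, 1, 0⟩) (z := e.symm ⟨0, 0, 0, 1⟩)
    (fun h => ?_) (fun x => EquivLike.injective e ?_) fun r h => ?_
  · simpa [zero_def] using congrArg (fun x => (e x).c4) h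
  · rw [LieEquiv.map_lie, LieEquiv.apply_symm_apply]
    simp [lie_def, zero_def]
  · simpa [LieEquiv.map_lie, lie_def, smul_def] using congrArg (fun x => (e x).c1) h

end A36A1

section Transport

variable {𝔤 𝔥 : Type*} [LieRing 𝔤] [LieAlgebra ℝ 𝔤] [LieRing 𝔥] [LieAlgebra ℝ 𝔥]

/-- The pullback of a metric along an isomorphism of Lie algebras. -/
def Metric.pullback (g : Metric 𝔥) (e : 𝔤 ≃ₗ⁅ℝ⁆ 𝔥) : Metric 𝔤 where
  form := g.form.compl₁₂ (e : 𝔤 →ₗ[ℝ] 𝔥) (e : 𝔤 →ₗ[ℝ] 𝔥)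
  symm _ _ := g.symm _ _
  pos _ hx := g.pos _ fun h => hx (e.injective (h.trans (map_zero e).symm))

theorem Metric.pullback_form (g : Metric 𝔥) (e : 𝔤 ≃ₗ⁅ℝ⁆ 𝔥) (x y : 𝔤) :
    (g.pullback e).form x y = g.form (e x) (e y) := rfl

variable [FiniteDimensional ℝ 𝔤] [FiniteDimensional ℝ 𝔥] {g : Metric 𝔥}

theorem map_nabla_pullback (g : Metric 𝔥) (e : 𝔤 ≃ₗ⁅ℝ⁆ 𝔥) (x y : 𝔤) :
    e (nabla (g.pullback e) x y) = nabla g (e x) (e y) := by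
  refine g.ext_form fun z => ?_
  obtain ⟨z, rfl⟩ := EquivLike.surjective e z
  rw [← g.pullback_form e, form_nabla, form_nabla]
  simp only [Metric.pullback_form, LieEquiv.map_lie]

theorem IsFlat.pullback (hg : IsFlat g) (e : 𝔤 ≃ₗ⁅ℝ⁆ 𝔥) : IsFlat (g.pullback e) :=
  fun x y z => EquivLike.injective e <| by
    rw [map_zero, ← hg (e x) (e y) (e z)]
    simp only [curvature, map_sub, map_nabla_pullback, LieEquiv.map_lie]

theorem A36A1.exists_isAH1_not_isKahler (e : 𝔤 ≃ₗ⁅ℝ⁆ A36A1) :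
    ∃ (g : Metric 𝔤) (J : 𝔤 →ₗ[ℝ] 𝔤), IsCompatible g J ∧ IsAH1 g J ∧ ¬IsKahler g J := by
  obtain ⟨J, hJ, hK⟩ := exists_isCompatible_not_isKahler e (stdMetric.pullback e)
  exact ⟨_, J, hJ, (isFlat_stdMetric.pullback e).isAH1 J, hK⟩

end Transport

end LieAH

theorem theorem6p1_general :
    (∀ (𝔤 : Type*) [LieRing 𝔤] [LieAlgebra ℝ 𝔤] [FiniteDimensional ℝ 𝔤],
      Module.finrank ℝ 𝔤 = 4 →
        ((∃ (g : Metric 𝔤) (J : 𝔤 →ₗ[ℝ] 𝔤),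
            IsCompatible g J ∧ IsAH1 g J ∧ ¬IsKahler g J) ↔
          Nonempty (𝔤 ≃ₗ⁅ℝ⁆ A36A1))) ∧
    IsFlat A36A1.stdMetric ∧
    (∀ (𝔤 : Type*) [LieRing 𝔤] [LieAlgebra ℝ 𝔤] [FiniteDimensional ℝ 𝔤],
      Module.finrank ℝ 𝔤 = 4 → ∀ (g : Metric 𝔤) (J : 𝔤 →ₗ[ℝ] 𝔤), IsCompatible g J →
        ((IsAH1 g J ∧ ¬IsKahler g J) ↔ (IsFlat g ∧ ¬IsKahler g J))) ∧
    (∀ g : Metric A36A1, ∃ J : A36A1 →ₗ[ℝ] A36A1, IsCompatible g J ∧ ¬IsKahler g J) := by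
  refine ⟨fun 𝔤 _ _ _ hdim => ⟨?_, fun ⟨e⟩ => A36A1.exists_isAH1_not_isKahler e⟩,
    A36A1.isFlat_stdMetric, fun 𝔤 _ _ _ hdim g J hJ => ?_,
    A36A1.exists_isCompatible_not_isKahler LieEquiv.refl⟩
  · rintro ⟨g, J, hJ, hR, hK⟩
    exact hR.nonempty_lieEquiv hdim hJ hK
  · exact and_congr_left fun hK => ⟨fun hR => hR.isFlat hdim hJ hK, fun hg => hg.isAH1 J⟩

theorem theorem6p1 :
    (∀ (𝔤 : Type*) [LieRing 𝔤] [LieAlgebra ℝ 𝔤] [FiniteDimensional ℝ 𝔤],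
      Module.finrank ℝ 𝔤 = 4 →
        ((∃ (g : Metric 𝔤) (J : 𝔤 →ₗ[ℝ] 𝔤),
            IsCompatible g J ∧ IsAH1 g J ∧ ¬ IsKahler g J) ↔
          Nonempty (𝔤 ≃ₗ⁅ℝ⁆ A36A1))) ∧
    IsFlat A36A1.stdMetric ∧
    (∀ (g : Metric A36A1) (J : A36A1 →ₗ[ℝ] A36A1), IsCompatible g J →
      ((IsAH1 g J ∧ ¬ IsKahler g J) ↔ (IsFlat g ∧ ¬ IsKahler g J))) ∧
    (∀ g : Metric A36A1, IsFlat g →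
      ∃ J : A36A1 →ₗ[ℝ] A36A1, IsCompatible g J ∧ ¬ IsKahler g J) := by
  obtain ⟨hiff, hstd, hflat, hexists⟩ := theorem6p1_general
  exact ⟨hiff, hstd, hflat A36A1 A36A1.finrank_eq, fun g _ => hexists g⟩
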